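/- **Setting.** Fix an order $M\ge 1$, priors $\pi_1,\pi_2>0$ with $\pi_1+\pi_2=1$, and constants $C_0\ge 1$, $0<\kappa_1\le 1$, $\kappa_2\ge 2$, $\kappa_3>0$, $K>0$. For dimensions $d_1,\dots,d_M$ put $d=\prod_m d_m$. The tensor normal law $\mathcal{TN}(\mathcal M;\boldsymbol\Sigma)$, $\boldsymbol\Sigma=[\Sigma_m]_{m=1}^M$, is the law of $\mathcal M+\mathcal Z\times_{m=1}^M\Sigma_m^{1/2}$, where $\mathcal Z\in\mathbb R^{d_1\times\cdots\times d_M}$ has i.i.d. $N(0,1)$ entries. For $\theta=(\mathcal M_1,\mathcal M_2,\boldsymbol\Sigma)$ let $\mathcal D=\mathcal M_2-\mathcal M_1$, $\mathcal B=\mathcal D\times_{m=1}^M\Sigma_m^{-1}$ (the discriminant tensor) and $\Delta(\theta)=\sqrt{\langle\mathcal B,\mathcal D\rangle}$. Let $(r_1,\dots,r_M)$ be a possible Tucker rank, i.e. $1\le r_m\le d_m$ and $r_m\le\prod_{j\ne m}r_j$ for all $m$, and put $r=\prod_m r_m$. Let $\mathcal H$ be the set of all $\theta$ with symmetric positive definite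 $\Sigma_m\in\mathbb R^{d_m\times d_m}$ such that $$C_0^{-1}\le\lambda_{\min}(\otimes_m\Sigma_m)\le\lambda_{\max}(\otimes_m\Sigma_m)\le C_0$$ and $\mathcal B=\mathcal F\times_{m=1}^M U_m$ for some $\mathcal F\in\mathbb R^{r_1\times\cdots\times r_M}$ and $U_m\in\mathbb R^{d_m\times r_m}$ with orthonormal columns. *Data.* For $k=1,2$, there are $n_k$ independent observations $\mathcal X^{(k)}_i\sim\mathcal{TN}(\mathcal M_k;\boldsymbol\Sigma)$, and the two classes are independent. Only the entries marked by a random pattern $\mathscr S=(\mathcal S^{(k)}_i)$ of binary tensors are observed; $\mathscr S$ is independent of the data and has law $\mathcal G$. For a mode $m$ and two multi-indices $I,J$ that differ at most in their $m$-th coordinate, let $n^{(k)}_{I,J}(\mathscr S)$ be the number of observations of class $k$ in which the entries $I$ and $J$ are both observed. Let $n_*=\min(n^{(1)}_{I,J}+n^{(2)}_{I,J})$ and $n_*^{(k)}=\min n^{(k)}_{I,J}$, the minima being over all such $m,I,J$. Given an integer $n_0$ with $1\le n_0\le\min(n_1,n_2)$, let $\Upsilon(n_0)$ be the set of all laws $\mathcal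 G$ under which, with probability at least $1-d^{-\kappa_3}$, $$\kappa_1n_0\le n_*(\mathscr S)\le\kappa_2n_0\quad\text{and}\quad n_*^{(k)}(\mathscr S)\ge\kappa_1n_0\ \ (k=1,2).$$ *Risk.* A classifier $\hat\delta$ is a measurable rule, built from $\mathscr S$ and the observed entries, that assigns to each tensor $\mathcal Z$ one of the two classes. Given the training sample, $R_\theta(\hat\delta)$ is its probability of misclassifying a new $\mathcal Z\sim\pi_1\mathcal{TN}(\mathcal M_1;\boldsymbol\Sigma)+\pi_2\mathcal{TN}(\mathcal M_2;\boldsymbol\Sigma)$. With $\phi$ the standard normal distribution function and $\Delta=\Delta(\theta)$, the risk of the oracle Fisher rule is $$R_{\rm opt}(\theta)=\pi_1\phi\big(\Delta^{-1}\log(\pi_2/\pi_1)-\Delta/2\big)+\pi_2\big(1-\phi(\Delta^{-1}\log(\pi_2/\pi_1)+\Delta/2)\big).$$ For $\Delta>0$ and $t\in\mathbb R$ let $$p(\Delta,t)=\inf_{\hat\delta}\ \sup_{\theta\in\mathcal H,\ \Delta(\theta)=\Delta,\ \mathcal G\in\Upsilon(n_0)}\mathbb P_{\theta,\mathcal G}\big(R_\theta(\hat\delta)-R_{\rm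 opt}(\theta)\ge t\big),$$ the infimum being over all classifiers. **Theorem (lower bound of the misclassification rate).** Let $\alpha>0$. (i) For all $0<c_1<c_2$ there is a constant $C_\alpha>0$, depending only on $\alpha,c_1,c_2$ and the fixed quantities $M,\pi_1,\pi_2,C_0,\kappa_1,\kappa_2,\kappa_3,K$, such that for all $d_m,r_m,n_1,n_2,n_0$ as above and all $\Delta\in(c_1,c_2]$ with $(\sum_md_mr_m+r)/n_0\le K\Delta$, $$p\Big(\Delta,\ C_\alpha\frac{\sum_{m=1}^Md_mr_m+r}{n_0}\Big)\ge1-\alpha.$$ (ii) There is a constant $C_\alpha>0$, depending only on $\alpha$ and the fixed quantities, such that the following holds. Let $d_m,r_m,n_1,n_2,n_0$ and $\Delta$ depend on an index $n\in\mathbb N$, be as above for each $n$, and satisfy $\Delta=\Delta_n\to\infty$ as $n\to\infty$ and $(\sum_md_mr_m+r)/n_0\le K\Delta_n$ for all $n$. Then there is a sequence $\vartheta_n\to0$ such that for all $n$ $$p\Big(\Delta_n,\ C_\alpha\exp\Big\{-\Big(\frac18+\vartheta_n\Big)\Delta_n^2\Big\}\frac{\sum_{m=1}^Md_mr_m+r}{n_0}\Big)\ge1-\alpha.$$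 -/

import Mathlib

open MeasureTheory ProbabilityTheory Filter Topology
open scoped Matrix MatrixOrder ENNReal

noncomputable section

namespace TensorLDA

/-- Multi-indices `(i_1, …, i_M)` with `i_m ∈ [d_m]`. -/
abbrev Idx {M : ℕ} (d : Fin M → ℕ) : Type := (m : Fin M) → Fin (d m)

/-- Real tensors of size `d_1 × ⋯ × d_M`. -/
abbrev Tensor {M : ℕ} (d : Fin M → ℕ) : Type := Idx d → ℝ

/-- Entrywise inner product of two tensors. -/
def inner {M : ℕ} {d : Fin M → ℕ} (X Y : Tensor d) : ℝ := ∑ I, X I * Y I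

/-- The product in all modes `X ×_{m=1}^M A_m`, with `A_m` of size `d'_m × d_m`. -/
def modeProd {M : ℕ} {d d' : Fin M → ℕ}
    (X : Tensor d) (A : (m : Fin M) → Matrix (Fin (d' m)) (Fin (d m)) ℝ) : Tensor d' :=
  fun I => ∑ J : Idx d, X J * ∏ m, A m (I m) (J m)

/-- The Kronecker product `⊗_m Σ_m`, with rows and columns labelled by multi-indices. -/
def kron {M : ℕ} {d : Fin M → ℕ} (S : (m : Fin M) → Matrix (Fin (d m)) (Fin (d m)) ℝ) :
    Matrix (Idx d) (Idx d) ℝ :=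
  Matrix.of fun I J => ∏ m, S m (I m) (J m)

/-- The tensor normal law: the law of `μ + Z ×_{m=1}^M Σ_m^{1/2}`, where the entries of `Z` are
independent standard normal variables and `Σ_m^{1/2}` is the positive semidefinite square root. -/
def tensorNormal {M : ℕ} {d : Fin M → ℕ} (μ : Tensor d)
    (S : (m : Fin M) → Matrix (Fin (d m)) (Fin (d m)) ℝ) : Measure (Tensor d) :=
  (Measure.pi fun _ : Idx d => gaussianReal 0 1).map
    fun Z => μ + modeProd Z (fun m => CFC.sqrt (S m))

/-- Parameters `θ = (M_1, M_2, Σ)`. The two classes are labelled by `0` and `1` in `Fin 2`;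
`mean 0` is the mean of class 1 and `mean 1` the mean of class 2. -/
structure Param {M : ℕ} (d : Fin M → ℕ) where
  mean : Fin 2 → Tensor d
  cov : (m : Fin M) → Matrix (Fin (d m)) (Fin (d m)) ℝ

namespace Param

variable {M : ℕ} {d : Fin M → ℕ} (θ : Param d)

/-- The mean difference `D = M_2 - M_1`. -/
def diff : Tensor d := θ.mean 1 - θ.mean 0

/-- The discriminant tensor `B = D ×_{m=1}^M Σ_m⁻¹`. -/
def discr : Tensor d := modeProd θ.diff fun m => (θ.cov m)⁻¹

/-- The signal-to-noise ratio `Δ = ⟨B, D⟩^{1/2}`. -/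
def snr : ℝ := Real.sqrt (inner θ.discr θ.diff)

/-- The law of a predictor of class `k`. -/
def law (k : Fin 2) : Measure (Tensor d) := tensorNormal (θ.mean k) θ.cov

/-- The misclassification error of a fixed rule, for a new point from the mixture with prior
probabilities `w 0`, `w 1`. -/
def risk (w : Fin 2 → ℝ) (rule : Tensor d → Fin 2) : ℝ :=
  ∑ k, w k * (θ.law k).real {z | rule z ≠ k}

/-- The optimal misclassification rate
`π_1 φ(Δ⁻¹ log(π_2/π_1) - Δ/2) + π_2 (1 - φ(Δ⁻¹ log(π_2/π_1) + Δ/2))`, with `φ` the standard normal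
distribution function. -/
def optRisk (w : Fin 2 → ℝ) : ℝ :=
  w 0 * cdf (gaussianReal 0 1) (θ.snr⁻¹ * Real.log (w 1 / w 0) - θ.snr / 2) +
    w 1 * (1 - cdf (gaussianReal 0 1) (θ.snr⁻¹ * Real.log (w 1 / w 0) + θ.snr / 2))

end Param

/-- The parameter space: well-conditioned covariances and a discriminant tensor
`B = F ×_{m=1}^M U_m` with `F` of size `r_1 × ⋯ × r_M` and orthonormal columns in each `U_m`. -/
def paramSpace {M : ℕ} (d r : Fin M → ℕ) (C₀ : ℝ) : Set (Param d) :=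
  {θ | (∀ m, (θ.cov m).PosDef) ∧
    (∀ x ∈ spectrum ℝ (kron θ.cov), C₀⁻¹ ≤ x ∧ x ≤ C₀) ∧
    ∃ (F : Tensor r) (U : (m : Fin M) → Matrix (Fin (d m)) (Fin (r m)) ℝ),
      (∀ m, (U m)ᵀ * U m = 1) ∧ θ.discr = modeProd F U}

/-- Sizes for which `(r_1, …, r_M)` can be the Tucker rank of a `d_1 × ⋯ × d_M` tensor:
`1 ≤ r_m ≤ d_m` and `r_m ≤ ∏_{j ≠ m} r_j`. -/
def IsTuckerRank {M : ℕ} (d r : Fin M → ℕ) : Prop :=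
  ∀ m, 1 ≤ r m ∧ r m ≤ d m ∧ r m ≤ ∏ j ∈ Finset.univ.erase m, r j

/-- The number of degrees of freedom `∑_m d_m r_m + r`, with `r = ∏_m r_m`. -/
def dof {M : ℕ} (d r : Fin M → ℕ) : ℝ := ∑ m, (d m : ℝ) * (r m : ℝ) + ∏ m, (r m : ℝ)

/-- Training data: `n k` tensors from class `k`. -/
abbrev Sample {M : ℕ} (d : Fin M → ℕ) (n : Fin 2 → ℕ) : Type :=
  (k : Fin 2) → Fin (n k) → Tensor d

/-- Missingness patterns: `true` marks an observed entry. -/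
abbrev Pattern {M : ℕ} (d : Fin M → ℕ) (n : Fin 2 → ℕ) : Type :=
  (k : Fin 2) → Fin (n k) → Idx d → Bool

/-- The law of the complete training data: independent observations, of law `θ.law k` in
class `k`. -/
def sampleLaw {M : ℕ} {d : Fin M → ℕ} (n : Fin 2 → ℕ) (θ : Param d) : Measure (Sample d n) :=
  Measure.pi fun k => Measure.pi fun _ : Fin (n k) => θ.law k

/-- The observed part of the data; missing entries are replaced by `0`. -/
def mask {M : ℕ} {d : Fin M → ℕ} {n : Fin 2 → ℕ} (S : Pattern d n) (X : Sample d n) :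
    Sample d n :=
  fun k i I => if S k i I then X k i I else 0

section EffectiveSampleSize

variable {M : ℕ} {d : Fin M → ℕ} {n : Fin 2 → ℕ} (S : Pattern d n)

/-- The number of observations of class `k` in which both entries `I` and `J` are observed. -/
def pairCount (k : Fin 2) (I J : Idx d) : ℕ :=
  (Finset.univ.filter fun i : Fin (n k) => S k i I = true ∧ S k i J = true).card

/-- The effective sample size `n_*`: the least number of observations, in the two classes
together, in which two entries of a common mode-`m` fibre are both observed. Two such entries are
`I` and the multi-index obtained from `I` by changing `I m` to `l`. -/
def effSize : ℕ :=
  ⨅ (m : Fin M) (I : Idx d) (l : Fin (d m)), ∑ k, pairCount S k I (Function.update I m l)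

/-- The effective sample size of class `k` alone. -/
def effSizeClass (k : Fin 2) : ℕ :=
  ⨅ (m : Fin M) (I : Idx d) (l : Fin (d m)), pairCount S k I (Function.update I m l)

end EffectiveSampleSize

/-- The space of missingness laws under which, with probability at least `1 - d^{-c₃}`, the
effective sample size is of order `n₀`, and no class is left with an effective sample size below
`c₁ n₀`. -/
def missingLaws {M : ℕ} (d : Fin M → ℕ) (n : Fin 2 → ℕ) (n₀ : ℕ) (c₁ c₂ c₃ : ℝ) :
    Set (Measure (Pattern d n)) :=
  {G | IsProbabilityMeasure G ∧
    ENNReal.ofReal (1 - ((∏ m, d m : ℕ) : ℝ) ^ (-c₃)) ≤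
      G {S | c₁ * n₀ ≤ (effSize S : ℝ) ∧ (effSize S : ℝ) ≤ c₂ * n₀ ∧
        ∀ k, c₁ * n₀ ≤ (effSizeClass S k : ℝ)}}

/-- Data-driven classification rules: measurable functions of the missingness pattern, the
training data and the point to be classified. -/
structure Classifier {M : ℕ} (d : Fin M → ℕ) (n : Fin 2 → ℕ) where
  toFun : Pattern d n → Sample d n → Tensor d → Fin 2
  measurable' :
    Measurable fun x : Pattern d n × Sample d n × Tensor d => toFun x.1 x.2.1 x.2.2

/-- The excess misclassification risk `R_θ(δ) - R_opt(θ)` of the classifier `δ` trained on the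
observed part of the data `X` under the missingness pattern `S`. -/
def excessRisk {M : ℕ} {d : Fin M → ℕ} {n : Fin 2 → ℕ} (w : Fin 2 → ℝ) (θ : Param d)
    (δ : Classifier d n) (S : Pattern d n) (X : Sample d n) : ℝ :=
  θ.risk w (δ.toFun S (mask S X)) - θ.optRisk w

/-- The minimax probability that the excess risk is at least `t`: the infimum over all
classifiers of the supremum over the parameters with signal-to-noise ratio `Δ` and over the
missingness laws. The pattern is independent of the data. -/
def minimaxProb {M : ℕ} (d r : Fin M → ℕ) (n : Fin 2 → ℕ) (n₀ : ℕ) (C₀ c₁ c₂ c₃ : ℝ)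
    (w : Fin 2 → ℝ) (Δ t : ℝ) : ℝ≥0∞ :=
  ⨅ δ : Classifier d n, ⨆ θ ∈ {θ ∈ paramSpace d r C₀ | θ.snr = Δ},
    ⨆ G ∈ missingLaws d n n₀ c₁ c₂ c₃,
      (G.prod (sampleLaw n θ)) {x | t ≤ excessRisk w θ δ x.1 x.2}

end TensorLDA

end

/-!
The bound is already attained at parameters with identity covariances and at the missingness law
that shows the first `n₀` observations of each class completely and nothing else. There the data
are `2 n₀` Gaussian tensors with identity covariance and means `a ∓ B / 2`, where `B` is the
discriminant tensor and `‖B‖ = Δ`.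

*Excess risk.* Let `T` be the log-likelihood ratio of the classes. Against the Gaussian law centred
at the midpoint `a`, the two weighted class densities are
`√(π₁ π₂) exp (-Δ² / 8) exp (∓ T / 2)`, so the excess risk of a rule is at least
`√(π₁ π₂) exp (-Δ² / 8)` times the integral of `|T|` over the region where the rule differs from the
Bayes rule (`le_excess_risk`). This is where the factor `exp (-Δ² / 8)` comes from. Where the ratios
of two parameters have opposite signs, any rule errs under one of them. For discriminant tensors
`B`, `B'` of the same norm, `(B + B') / 2` and `(B - B') / 2` are orthogonal, so the corresponding
linear forms are independent Gaussians, and the two excess risks add up to at least a multiple of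
`‖B - B'‖²` (`separation_direction`). Two midpoints on the axis of `B` are treated likewise
(`separation_shift`).

*Many hypotheses.* Take parameters indexed by a grid `J → Fin q`, with spacing of order `1 / √n₀`
in each coordinate, such that neighbours in the grid have nearly the same law of the data, by the
chi-square divergence of Gaussian laws (`ChiSqLe`). No estimator then recovers a given coordinate of
a uniformly random grid point with probability much above `1 / q`, so by Markov's inequality it
misses more than half of the coordinates with probability close to `1` (`exists_measureReal_le`).
A rule with small excess risk would determine at least half of the coordinates, by the separation
bounds (`le_minimaxProb`). Large `q` and small spacing give probability `1 - α`, for any number of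
coordinates.

*Dimension count.* It remains to find, up to a constant factor, `∑ d_m r_m + r` entries of `B` that
can be moved freely under the rank constraint: either the entries of the core, or the rows of one
loading matrix beyond the first `r_m` (`exists_isFreeFamily`); a multiple of a fixed unit tensor,
orthogonal to the moved entries, restores the norm `Δ`. If the core is a single number and these
families are too small, moving the midpoint suffices. All other factors are at least
`exp (-A (1 + Δ + Δ⁻²))`, which is bounded below for `Δ` in a compact subset of `(0, ∞)`, and is
`exp (o(Δ²))` as `Δ → ∞`.
-/

noncomputable section

namespace TensorLDA

/-! ### Likelihood ratios and the chi-square divergence -/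

/-- `P` has a density with respect to `Q` whose second moment under `Q` is at most `exp c`; for
probability measures this says that the chi-square divergence of `P` from `Q` is at most
`exp c - 1`. -/
def ChiSqLe {Ω : Type*} [MeasurableSpace Ω] (P Q : Measure Ω) (c : ℝ) : Prop :=
  ∃ L : Ω → ℝ, Measurable L ∧ (∀ x, 0 ≤ L x) ∧ Integrable (fun x => L x ^ 2) Q ∧
    ∫ x, L x ^ 2 ∂Q ≤ Real.exp c ∧ P = Q.withDensity fun x => ENNReal.ofReal (L x)

lemma chiSqLe_refl {Ω : Type*} [MeasurableSpace Ω] (P : Measure Ω) [IsProbabilityMeasure P] :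
    ChiSqLe P P 0 :=
  ⟨fun _ => 1, measurable_const, fun _ => zero_le_one, by simp, by simp, by simp⟩

lemma integrable_of_withDensity {Ω : Type*} [MeasurableSpace Ω] {P Q : Measure Ω}
    [IsProbabilityMeasure P] {L : Ω → ℝ} (hL : Measurable L) (h0 : ∀ x, 0 ≤ L x)
    (hP : P = Q.withDensity fun x => ENNReal.ofReal (L x)) :
    Integrable L Q ∧ ∫ x, L x ∂Q = 1 := by
  have h1 : ∫⁻ x, ENNReal.ofReal (L x) ∂Q = 1 := by
    have := measure_univ (μ := P)
    rwa [hP, withDensity_apply _ MeasurableSet.univ, Measure.restrict_univ] at this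
  refine ⟨⟨hL.aestronglyMeasurable, ?_⟩, ?_⟩
  · rw [hasFiniteIntegral_iff_ofReal (Eventually.of_forall h0), h1]
    exact ENNReal.one_lt_top
  · rw [integral_eq_lintegral_of_nonneg_ae (Eventually.of_forall h0) hL.aestronglyMeasurable, h1]
    simp

lemma pi_eq_withDensity_prod {ι : Type*} [Fintype ι] {Ω : ι → Type*}
    [∀ i, MeasurableSpace (Ω i)] {P Q : ∀ i, Measure (Ω i)} [∀ i, IsProbabilityMeasure (P i)]
    [∀ i, IsProbabilityMeasure (Q i)] {L : ∀ i, Ω i → ℝ} (hL : ∀ i, Measurable (L i))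
    (h0 : ∀ i x, 0 ≤ L i x) (hP : ∀ i, P i = (Q i).withDensity fun x => ENNReal.ofReal (L i x)) :
    Measure.pi P = (Measure.pi Q).withDensity fun x => ENNReal.ofReal (∏ i, L i (x i)) := by
  refine Measure.pi_eq fun s hs => ?_
  rw [withDensity_apply _ (MeasurableSet.univ_pi hs),
    ← lintegral_indicator (MeasurableSet.univ_pi hs)]
  have h1 : ∀ x : (i : ι) → Ω i,
      (Set.univ.pi s).indicator (fun x => ENNReal.ofReal (∏ i, L i (x i))) x =
        ENNReal.ofReal (∏ i, (s i).indicator (L i) (x i)) := by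
    intro x
    by_cases hx : x ∈ Set.univ.pi s
    · rw [Set.indicator_of_mem hx]
      congr 1
      exact Finset.prod_congr rfl fun i _ =>
        (Set.indicator_of_mem (hx i (Set.mem_univ i)) _).symm
    · rw [Set.indicator_of_notMem hx]
      simp only [Set.mem_pi, Set.mem_univ, true_imp_iff, not_forall] at hx
      obtain ⟨i, hi⟩ := hx
      rw [Finset.prod_eq_zero (Finset.mem_univ i) (Set.indicator_of_notMem hi _)]
      simp
  have hint : ∀ i, Integrable ((s i).indicator (L i)) (Q i) := fun i =>
    (integrable_of_withDensity (hL i) (h0 i) (hP i)).1.indicator (hs i)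
  have hnn : ∀ i x, 0 ≤ (s i).indicator (L i) x := fun i x =>
    Set.indicator_nonneg (fun x _ => h0 i x) x
  simp_rw [h1]
  rw [← ofReal_integral_eq_lintegral_ofReal (Integrable.fintype_prod_dep hint)
    (Eventually.of_forall fun x => Finset.prod_nonneg fun i _ => hnn i _),
    integral_fintype_prod_eq_prod, ENNReal.ofReal_prod_of_nonneg
      fun i _ => integral_nonneg (hnn i)]
  refine Finset.prod_congr rfl fun i _ => ?_
  rw [ofReal_integral_eq_lintegral_ofReal (hint i) (Eventually.of_forall (hnn i)), hP i,
    withDensity_apply _ (hs i), ← lintegral_indicator (hs i)]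
  refine lintegral_congr fun x => ?_
  by_cases hx : x ∈ s i <;> simp [hx]

lemma ChiSqLe.pi {ι : Type*} [Fintype ι] {Ω : ι → Type*} [∀ i, MeasurableSpace (Ω i)]
    {P Q : ∀ i, Measure (Ω i)} [∀ i, IsProbabilityMeasure (P i)]
    [∀ i, IsProbabilityMeasure (Q i)] {c : ι → ℝ} (h : ∀ i, ChiSqLe (P i) (Q i) (c i)) :
    ChiSqLe (Measure.pi P) (Measure.pi Q) (∑ i, c i) := by
  choose L hL h0 hint hc hP using h
  refine ⟨fun x => ∏ i, L i (x i),
    Finset.measurable_prod _ fun i _ => (hL i).comp (measurable_pi_apply i),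
    fun x => Finset.prod_nonneg fun i _ => h0 i _, ?_, ?_, pi_eq_withDensity_prod hL h0 hP⟩
  · simp_rw [← Finset.prod_pow]
    exact Integrable.fintype_prod_dep (f := fun i x => L i x ^ 2) hint
  · simp_rw [← Finset.prod_pow]
    rw [integral_fintype_prod_eq_prod (fun i x => L i x ^ 2), Real.exp_sum]
    exact Finset.prod_le_prod (fun i _ => integral_nonneg fun x => sq_nonneg _) fun i _ => hc i

/-- The pointwise bound `L ≤ 1 + δ / 2 + (L - 1) ^ 2 / (2 δ)` controls the total variation distance
by the chi-square divergence. -/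
lemma ChiSqLe.measureReal_le {Ω : Type*} [MeasurableSpace Ω] {P Q : Measure Ω}
    [IsProbabilityMeasure P] [IsProbabilityMeasure Q] {c : ℝ} (h : ChiSqLe P Q c) {δ : ℝ}
    (hδ : 0 < δ) {s : Set Ω} (hs : MeasurableSet s) :
    P.real s ≤ Q.real s + δ / 2 + (Real.exp c - 1) / (2 * δ) := by
  obtain ⟨L, hL, h0, hint, hc, hP⟩ := h
  obtain ⟨hLi, hL1⟩ := integrable_of_withDensity hL h0 hP
  have h2 : P.real s = ∫ x in s, L x ∂Q := by
    rw [integral_eq_lintegral_of_nonneg_ae (Eventually.of_forall h0) hL.aestronglyMeasurable,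
      Measure.real, hP, withDensity_apply _ hs]
  have hg : Integrable (fun x => L x ^ 2 - 2 * L x + 1) Q :=
    (hint.sub (hLi.const_mul 2)).add (integrable_const 1)
  have hg0 : ∀ x, 0 ≤ L x ^ 2 - 2 * L x + 1 := fun x => by nlinarith [sq_nonneg (L x - 1)]
  have hgi : ∫ x, (L x ^ 2 - 2 * L x + 1) ∂Q ≤ Real.exp c - 1 := by
    have h1 : ∫ x, (L x ^ 2 - 2 * L x + 1) ∂Q =
        ∫ x, L x ^ 2 ∂Q - 2 * ∫ x, L x ∂Q + 1 := by
      rw [← integral_const_mul, ← integral_sub hint (hLi.const_mul 2)]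
      have := integral_add (hint.sub (hLi.const_mul 2)) (integrable_const (μ := Q) (1 : ℝ))
      simpa using this
    rw [h1, hL1]
    linarith
  have h5 : ∀ x, L x ≤ 1 + δ / 2 + (L x ^ 2 - 2 * L x + 1) / (2 * δ) := fun x => by
    have : 1 + δ / 2 + (L x ^ 2 - 2 * L x + 1) / (2 * δ) - L x =
        (L x - 1 - δ) ^ 2 / (2 * δ) := by field_simp; ring
    have h : 0 ≤ (L x - 1 - δ) ^ 2 / (2 * δ) := by positivity
    linarith
  have hgs : ∫ x in s, (L x ^ 2 - 2 * L x + 1) ∂Q ≤ Real.exp c - 1 :=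
    (setIntegral_le_integral hg (Eventually.of_forall hg0)).trans hgi
  calc P.real s = ∫ x in s, L x ∂Q := h2
    _ ≤ ∫ x in s, (1 + δ / 2 + (L x ^ 2 - 2 * L x + 1) / (2 * δ)) ∂Q :=
        integral_mono hLi.integrableOn
          ((integrable_const _).add (hg.integrableOn.div_const _)) h5
    _ = Q.real s * (1 + δ / 2) + (∫ x in s, (L x ^ 2 - 2 * L x + 1) ∂Q) / (2 * δ) := by
        rw [integral_add (integrable_const _) (hg.integrableOn.div_const _), integral_div]
        simp
    _ ≤ (Q.real s + 1 * (δ / 2)) + (Real.exp c - 1) / (2 * δ) := by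
        rw [mul_add, mul_one]
        gcongr
        exact measureReal_le_one
    _ = _ := by ring

/-! ### Gaussian vectors with independent coordinates -/

lemma gaussianReal_eq_withDensity (μ ν : ℝ) :
    gaussianReal μ 1 = (gaussianReal ν 1).withDensity
      fun x => ENNReal.ofReal (Real.exp ((μ - ν) * (x - ν) - (μ - ν) ^ 2 / 2)) := by
  rw [gaussianReal_of_var_ne_zero _ one_ne_zero, gaussianReal_of_var_ne_zero _ one_ne_zero,
    ← withDensity_mul _ (measurable_gaussianPDF _ _) (by fun_prop)]
  congr 1
  ext x
  rw [Pi.mul_apply, gaussianPDF, gaussianPDF, ← ENNReal.ofReal_mul (gaussianPDFReal_nonneg _ _ _),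
    gaussianPDFReal_def, gaussianPDFReal_def]
  simp only [mul_assoc]
  rw [← Real.exp_add]
  congr 3
  simp
  ring_nf

lemma chiSqLe_gaussianReal (μ ν : ℝ) :
    ChiSqLe (gaussianReal μ 1) (gaussianReal ν 1) ((μ - ν) ^ 2) := by
  have h1 : ∀ x : ℝ, Real.exp ((μ - ν) * (x - ν) - (μ - ν) ^ 2 / 2) ^ 2 =
      Real.exp (-(2 * (μ - ν) * ν) - (μ - ν) ^ 2) * Real.exp (2 * (μ - ν) * x) := by
    intro x
    rw [sq, ← Real.exp_add, ← Real.exp_add]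
    ring_nf
  refine ⟨_, by fun_prop, fun x => (Real.exp_pos _).le, ?_, ?_, gaussianReal_eq_withDensity μ ν⟩
  · simp_rw [h1]
    exact (integrable_exp_mul_gaussianReal _).const_mul _
  · simp_rw [h1]
    rw [integral_const_mul]
    have := congrFun (mgf_fun_id_gaussianReal (μ := ν) (v := 1)) (2 * (μ - ν))
    rw [mgf] at this
    rw [this, ← Real.exp_add]
    apply le_of_eq
    simp
    ring

/-- The law of a Gaussian vector with mean `μ` and identity covariance matrix. -/
abbrev gaussianPi {ι : Type*} [Fintype ι] (μ : ι → ℝ) : Measure (ι → ℝ) :=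
  Measure.pi fun i => gaussianReal (μ i) 1

variable {ι : Type*} [Fintype ι]

lemma gaussianPi_eq_withDensity (μ ν : ι → ℝ) :
    gaussianPi μ = (gaussianPi ν).withDensity fun x =>
      ENNReal.ofReal (Real.exp ((μ - ν) ⬝ᵥ (x - ν) - (μ - ν) ⬝ᵥ (μ - ν) / 2)) := by
  rw [gaussianPi, pi_eq_withDensity_prod (Q := fun i => gaussianReal (ν i) 1) (L := fun i x =>
    Real.exp ((μ i - ν i) * (x - ν i) - (μ i - ν i) ^ 2 / 2)) (fun i => by fun_prop)
    (fun i x => (Real.exp_pos _).le) (fun i => gaussianReal_eq_withDensity _ _)]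
  congr 1
  ext x
  rw [← Real.exp_sum, Finset.sum_sub_distrib]
  simp only [dotProduct, Pi.sub_apply, Finset.sum_div, sq]

lemma iIndepFun_gaussianPi (μ : ι → ℝ) :
    iIndepFun (fun i (x : ι → ℝ) => x i) (gaussianPi μ) :=
  iIndepFun_pi (μ := fun i => gaussianReal (μ i) 1) (X := fun _ x => x) fun _ => aemeasurable_id

lemma hasLaw_eval_gaussianPi (μ : ι → ℝ) (i : ι) :
    HasLaw (fun x : ι → ℝ => x i) (gaussianReal (μ i) 1) (gaussianPi μ) :=
  ⟨(measurable_pi_apply i).aemeasurable,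
    (measurePreserving_eval (fun i => gaussianReal (μ i) 1) i).map_eq⟩

lemma hasGaussianLaw_gaussianPi (μ : ι → ℝ) :
    HasGaussianLaw (fun (x : ι → ℝ) i => x i) (gaussianPi μ) :=
  iIndepFun.hasGaussianLaw (fun i => (hasLaw_eval_gaussianPi μ i).hasGaussianLaw)
    (iIndepFun_gaussianPi μ)

lemma memLp_eval_gaussianPi (μ : ι → ℝ) (i : ι) :
    MemLp (fun x : ι → ℝ => x i) 2 (gaussianPi μ) :=
  (hasLaw_eval_gaussianPi μ i).hasGaussianLaw.memLp_two

lemma covariance_dotProduct_gaussianPi (μ b c : ι → ℝ) :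
    cov[fun x => b ⬝ᵥ x, fun x => c ⬝ᵥ x; gaussianPi μ] = b ⬝ᵥ c := by
  classical
  have h : ∀ i j, cov[fun x : ι → ℝ => x i, fun x => x j; gaussianPi μ] =
      if i = j then 1 else 0 := by
    intro i j
    split_ifs with hij
    · subst hij
      rw [covariance_self (hasLaw_eval_gaussianPi μ i).aemeasurable,
        (hasLaw_eval_gaussianPi μ i).variance_eq]
      simp
    · exact ((iIndepFun_gaussianPi μ).indepFun hij).covariance_eq_zero
        (memLp_eval_gaussianPi μ i) (memLp_eval_gaussianPi μ j)
  simp only [dotProduct]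
  rw [covariance_fun_sum_fun_sum (fun i => (memLp_eval_gaussianPi μ i).const_mul _)
    (fun i => (memLp_eval_gaussianPi μ i).const_mul _)]
  simp_rw [covariance_const_mul_left, covariance_const_mul_right, h]
  simp

lemma hasGaussianLaw_dotProduct_pair (μ b c : ι → ℝ) :
    HasGaussianLaw (fun x => (b ⬝ᵥ x, c ⬝ᵥ x)) (gaussianPi μ) := by
  let f : (ι → ℝ) → (ι → ℝ) →L[ℝ] ℝ := fun b =>
    ∑ i, b i • ContinuousLinearMap.proj (R := ℝ) (φ := fun _ : ι => ℝ) i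
  have hf : ∀ b x, f b x = b ⬝ᵥ x := fun b x => by
    simp [f, dotProduct]
  have := (hasGaussianLaw_gaussianPi μ).map_fun ((f b).prod (f c))
  simpa [hf] using this

lemma indepFun_dotProduct_gaussianPi (μ : ι → ℝ) {b c : ι → ℝ} (h : b ⬝ᵥ c = 0) :
    IndepFun (fun x => b ⬝ᵥ x) (fun x => c ⬝ᵥ x) (gaussianPi μ) :=
  (hasGaussianLaw_dotProduct_pair μ b c).indepFun_of_covariance_eq_zero
    (by rw [covariance_dotProduct_gaussianPi, h])

lemma map_dotProduct_gaussianPi (μ b : ι → ℝ) :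
    (gaussianPi μ).map (fun x => b ⬝ᵥ x) = gaussianReal (b ⬝ᵥ μ) (b ⬝ᵥ b).toNNReal := by
  rw [(hasGaussianLaw_dotProduct_pair μ b b).fst.map_eq_gaussianReal]
  have h1 : ∫ x, b ⬝ᵥ x ∂(gaussianPi μ) = b ⬝ᵥ μ := by
    simp only [dotProduct]
    rw [integral_finsetSum _
      fun i _ => ((memLp_eval_gaussianPi μ i).integrable one_le_two).const_mul _]
    refine Finset.sum_congr rfl fun i _ => ?_
    rw [integral_const_mul, (hasLaw_eval_gaussianPi μ i).integral_eq]
    simp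
  rw [h1, ← covariance_self (hasGaussianLaw_dotProduct_pair μ b b).fst.aemeasurable,
    covariance_dotProduct_gaussianPi]

/-- Standard normal mass of an interval inside `[-R, R]`. -/
lemma le_gaussianReal_Icc {a b R : ℝ} (hab : a ≤ b) (ha : -R ≤ a) (hb : b ≤ R) :
    (b - a) * ((√(2 * Real.pi))⁻¹ * Real.exp (-R ^ 2 / 2)) ≤
      (gaussianReal 0 1).real (Set.Icc a b) := by
  rw [Measure.real, gaussianReal_apply_eq_integral 0 one_ne_zero, ENNReal.toReal_ofReal
    (integral_nonneg fun x => gaussianPDFReal_nonneg _ _ _)]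
  have h : ∀ x ∈ Set.Icc a b,
      (√(2 * Real.pi))⁻¹ * Real.exp (-R ^ 2 / 2) ≤ gaussianPDFReal 0 1 x := by
    intro x hx
    rw [gaussianPDFReal_def]
    simp only [NNReal.coe_one, mul_one, sub_zero]
    have : x ^ 2 ≤ R ^ 2 := sq_le_sq' (by linarith [hx.1]) (by linarith [hx.2])
    gcongr
  have h2 := setIntegral_mono_on (μ := volume) (s := Set.Icc a b)
    (integrableOn_const (C := (√(2 * Real.pi))⁻¹ * Real.exp (-R ^ 2 / 2)) (by simp))
    (integrable_gaussianPDFReal 0 1).integrableOn measurableSet_Icc h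
  simpa [hab] using h2

/-! ### Multiple hypotheses on a product grid -/

lemma sum_sum_update {J A : Type*} [Fintype J] [DecidableEq J] [Fintype A]
    (f : (J → A) → ℝ) (j : J) :
    ∑ v, ∑ a, f (Function.update v j a) = Fintype.card A * ∑ v, f v := by
  have hinv : Function.Involutive
      (fun x : (J → A) × A => (Function.update x.1 j x.2, x.1 j)) := by
    rintro ⟨v, a⟩
    simp
  have h := Equiv.sum_comp hinv.toPerm (fun x : (J → A) × A => f x.1)
  simp only [Function.Involutive.coe_toPerm, Fintype.sum_prod_type] at h
  rw [h]
  simp [Finset.mul_sum]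

/-- A uniformly random point of the grid `J → Fin q` cannot be recovered in half of its coordinates,
except with small probability, when changing one coordinate hardly changes the law of the data:
for some `v`, the event `A v`, on which `v` is determined up to half of its coordinates, is
unlikely. -/
theorem exists_measureReal_le {Ω J : Type*} [MeasurableSpace Ω] [Fintype J] [DecidableEq J]
    [Nonempty J] {q : ℕ} [NeZero q] (P : (J → Fin q) → Measure Ω)
    [∀ v, IsProbabilityMeasure (P v)] {c δ : ℝ} (hδ : 0 < δ)
    (hP : ∀ v j a, ChiSqLe (P (Function.update v j a)) (P v) c)
    (A : (J → Fin q) → Set Ω) (hA : ∀ v, MeasurableSet (A v))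
    (hAA : ∀ y v v', y ∈ A v → y ∈ A v' → 2 * hammingDist v v' ≤ Fintype.card J) :
    ∃ v, (P v).real (A v) ≤ 2 * (1 / q + (δ / 2 + (Real.exp c - 1) / (2 * δ))) := by
  classical
  set ε := δ / 2 + (Real.exp c - 1) / (2 * δ) with hε
  let H : Ω → Finset (J → Fin q) := fun y => Finset.univ.filter fun v => y ∈ A v
  have hH : ∀ p : Finset (J → Fin q) → Prop, MeasurableSet {y | p (H y)} := by
    intro p
    have h1 : ∀ h, MeasurableSet {y | H y = h} := by
      intro h
      have : {y | H y = h} = ⋂ v, {y | y ∈ A v ↔ v ∈ h} := by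
        ext y
        simp [H, Finset.ext_iff]
      rw [this]
      refine MeasurableSet.iInter fun v => ?_
      by_cases hv : v ∈ h
      · simpa [hv] using hA v
      · simp only [hv, iff_false]
        exact (hA v).compl
    have h2 : {y | p (H y)} = ⋃ h ∈ {h | p h}, {y | H y = h} := by
      ext y
      simp
    rw [h2]
    exact MeasurableSet.biUnion (Set.to_countable _) fun h _ => h1 h
  -- the decoder picks any of the grid points compatible with the data
  let g : Finset (J → Fin q) → (J → Fin q) := fun h => if hh : h.Nonempty then hh.choose else 0
  have hg : ∀ y v, y ∈ A v → y ∈ A (g (H y)) := by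
    intro y v hv
    have hne : (H y).Nonempty := ⟨v, by simp [H, hv]⟩
    have : g (H y) ∈ H y := by
      simp only [g, dif_pos hne]
      exact hne.choose_spec
    simpa [H] using this
  let E : J → Fin q → Set Ω := fun j a => {y | g (H y) j = a}
  have hE : ∀ j a, MeasurableSet (E j a) := fun j a => hH fun h => g h j = a
  have hN : 0 < (Fintype.card J : ℝ) := by exact_mod_cast Fintype.card_pos
  have hq : 0 < (q : ℝ) := by exact_mod_cast Nat.pos_of_ne_zero (NeZero.ne q)
  have h_correct : ∀ v,
      (Fintype.card J : ℝ) / 2 * (P v).real (A v) ≤ ∑ j, (P v).real (E j (v j)) := by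
    intro v
    have hpt : ∀ y, (A v).indicator (fun _ => (Fintype.card J : ℝ) / 2) y ≤
        ∑ j, (E j (v j)).indicator (fun _ => (1 : ℝ)) y := by
      intro y
      by_cases hy : y ∈ A v
      · rw [Set.indicator_of_mem hy]
        have h1 := hAA y _ _ (hg y v hy) hy
        have h2 : ∑ j, (E j (v j)).indicator (fun _ => (1 : ℝ)) y =
            (Finset.univ.filter fun j => g (H y) j = v j).card := by
          rw [Finset.card_filter]
          push_cast
          refine Finset.sum_congr rfl fun j _ => ?_
          simp [E, Set.indicator_apply]
        have h3 := Finset.card_filter_add_card_filter_not (s := Finset.univ)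
          (fun j => g (H y) j = v j)
        rw [h2]
        have h4 : Fintype.card J ≤ 2 * (Finset.univ.filter fun j => g (H y) j = v j).card := by
          rw [hammingDist] at h1
          rw [Finset.card_univ] at h3
          simp only [ne_eq] at h1
          omega
        have h5 : (Fintype.card J : ℝ) ≤
            2 * (Finset.univ.filter fun j => g (H y) j = v j).card := by
          exact_mod_cast h4
        linarith
      · rw [Set.indicator_of_notMem hy]
        exact Finset.sum_nonneg fun j _ => Set.indicator_nonneg (fun _ _ => zero_le_one) _
    have hi : ∀ j, Integrable ((E j (v j)).indicator (fun _ => (1 : ℝ))) (P v) := fun j =>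
      (integrable_const _).indicator (hE j _)
    have := integral_mono
      ((integrable_const (μ := P v) ((Fintype.card J : ℝ) / 2)).indicator (hA v))
      (integrable_finsetSum _ fun j _ => hi j) hpt
    rw [integral_finsetSum _ fun j _ => hi j, integral_indicator_const _ (hA v)] at this
    simp_rw [integral_indicator_const _ (hE _ _)] at this
    simpa [mul_comm] using this
  have h_guess : ∀ j, ∑ v, (P v).real (E j (v j)) ≤
      Fintype.card (J → Fin q) * (1 / q + ε) := by
    intro j
    have h1 := sum_sum_update (fun v => (P v).real (E j (v j))) j
    have h2 : ∀ v, ∑ a, (P (Function.update v j a)).real (E j (Function.update v j a j)) ≤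
        1 + q * ε := by
      intro v
      have h3 : ∀ a, (P (Function.update v j a)).real (E j (Function.update v j a j)) ≤
          (P v).real (E j a) + ε := by
        intro a
        rw [Function.update_self]
        have := (hP v j a).measureReal_le hδ (hE j a)
        rw [hε]; linarith
      have h4 : ∑ a, (P v).real (E j a) ≤ 1 := by
        rw [← measureReal_iUnion_fintype _ (hE j)]
        · exact measureReal_le_one
        · intro a b hab
          refine Set.disjoint_left.2 fun y hy hy' => hab ?_
          exact hy.symm.trans hy'
      calc _ ≤ ∑ a, ((P v).real (E j a) + ε) := Finset.sum_le_sum fun a _ => h3 a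
        _ ≤ _ := by
          rw [Finset.sum_add_distrib]
          simp only [Finset.sum_const, Finset.card_univ, Fintype.card_fin, nsmul_eq_mul]
          linarith
    have h5 : (q : ℝ) * ∑ v, (P v).real (E j (v j)) ≤
        Fintype.card (J → Fin q) * (1 + q * ε) := by
      rw [Fintype.card_fin] at h1
      rw [← h1]
      refine (Finset.sum_le_sum fun v _ => h2 v).trans (le_of_eq ?_)
      rw [Finset.sum_const, Finset.card_univ, nsmul_eq_mul]
    have h6 : (Fintype.card (J → Fin q) : ℝ) * (1 / q + ε) =
        Fintype.card (J → Fin q) * (1 + q * ε) / q := by field_simp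
    rw [h6, le_div_iff₀ hq]
    linarith
  by_contra! hcon
  have hV : (0 : ℝ) < Fintype.card (J → Fin q) := by exact_mod_cast Fintype.card_pos
  have h7 : ∑ v : J → Fin q, 2 * (1 / q + ε) < ∑ v, (P v).real (A v) :=
    Finset.sum_lt_sum_of_nonempty Finset.univ_nonempty fun v _ => hcon v
  have h8 : (Fintype.card J : ℝ) / 2 * ∑ v, (P v).real (A v) ≤
      Fintype.card J * (Fintype.card (J → Fin q) * (1 / q + ε)) := by
    rw [Finset.mul_sum]
    refine (Finset.sum_le_sum fun v _ => h_correct v).trans ?_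
    rw [Finset.sum_comm]
    refine (Finset.sum_le_sum fun j _ => h_guess j).trans ?_
    simp
  simp only [Finset.sum_const, Finset.card_univ, nsmul_eq_mul] at h7
  have h9 := mul_lt_mul_of_pos_left h7 (half_pos hN)
  linarith

/-! ### Observed data under identity covariances -/

section Data

variable {M : ℕ} {d : Fin M → ℕ}

lemma prod_one_apply (I J : Idx d) :
    ∏ m, (1 : Matrix (Fin (d m)) (Fin (d m)) ℝ) (I m) (J m) = if I = J then 1 else 0 := by
  split_ifs with h
  · subst h; simp
  · obtain ⟨m, hm⟩ : ∃ m, I m ≠ J m := by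
      by_contra! h'
      exact h (funext h')
    exact Finset.prod_eq_zero (i := m) (Finset.mem_univ m) (Matrix.one_apply_ne hm)

lemma modeProd_one (X : Tensor d) :
    modeProd X (fun m => (1 : Matrix (Fin (d m)) (Fin (d m)) ℝ)) = X := by
  funext I
  rw [modeProd]
  simp_rw [prod_one_apply]
  simp

lemma kron_one : kron (fun m => (1 : Matrix (Fin (d m)) (Fin (d m)) ℝ)) = 1 := by
  ext I J
  rw [kron, Matrix.of_apply, prod_one_apply, Matrix.one_apply]

/-- The parameter with identity covariances, midpoint `a` of the two means and mean difference
`B`, which is then also the discriminant tensor. -/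
def isoParam (a B : Tensor d) : Param d where
  mean := ![a - (1 / 2 : ℝ) • B, a + (1 / 2 : ℝ) • B]
  cov := fun _ => 1

lemma isoParam_diff (a B : Tensor d) : (isoParam a B).diff = B := by
  ext I
  simp [isoParam, Param.diff]
  ring

lemma isoParam_discr (a B : Tensor d) : (isoParam a B).discr = B := by
  rw [Param.discr, isoParam_diff]
  simp only [isoParam, inv_one]
  exact modeProd_one B

lemma isoParam_snr (a B : Tensor d) : (isoParam a B).snr = √(B ⬝ᵥ B) := by
  rw [Param.snr, isoParam_diff, isoParam_discr]
  rfl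

lemma isoParam_law (a B : Tensor d) (k : Fin 2) :
    (isoParam a B).law k = gaussianPi ((isoParam a B).mean k) := by
  have h : (fun Z : Tensor d => (isoParam a B).mean k + modeProd Z
      (fun m => CFC.sqrt ((isoParam a B).cov m))) = fun Z I => (isoParam a B).mean k I + Z I := by
    funext Z
    have : (fun m => CFC.sqrt ((isoParam a B).cov m)) =
        fun m => (1 : Matrix (Fin (d m)) (Fin (d m)) ℝ) := by
      funext m
      simp [isoParam]
    rw [this, modeProd_one]
    rfl
  have := Measure.pi_map_pi (μ := fun _ : Idx d => gaussianReal 0 1)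
    (f := fun I x => (isoParam a B).mean k I + x) fun I => by fun_prop
  rw [Param.law, tensorNormal, h, this]
  simp [gaussianPi, gaussianReal_map_const_add]

instance (a B : Tensor d) (k : Fin 2) : IsProbabilityMeasure ((isoParam a B).law k) := by
  rw [isoParam_law]; infer_instance

instance (n : Fin 2 → ℕ) (a B : Tensor d) :
    IsProbabilityMeasure (sampleLaw n (isoParam a B)) := by
  rw [sampleLaw]; infer_instance

lemma isoParam_mem_paramSpace {r : Fin M → ℕ} {C₀ : ℝ} (hC₀ : 1 ≤ C₀) {a B : Tensor d}
    (hB : ∃ (F : Tensor r) (U : (m : Fin M) → Matrix (Fin (d m)) (Fin (r m)) ℝ),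
      (∀ m, (U m)ᵀ * U m = 1) ∧ B = modeProd F U) :
    isoParam a B ∈ paramSpace d r C₀ := by
  refine ⟨fun m => Matrix.PosDef.one, fun x hx => ?_, by rwa [isoParam_discr]⟩
  have h1 : kron (isoParam a B).cov = 1 := kron_one
  rw [h1] at hx
  rcases isEmpty_or_nonempty (Idx d) with h | h
  · simp [spectrum.of_subsingleton] at hx
  · rw [spectrum.one_eq, Set.mem_singleton_iff] at hx
    subst hx
    exact ⟨inv_le_one_of_one_le₀ hC₀, hC₀⟩

lemma measurable_mask {n : Fin 2 → ℕ} (S : Pattern d n) : Measurable (mask S) := by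
  refine measurable_pi_lambda _ fun k => measurable_pi_lambda _ fun i =>
    measurable_pi_lambda _ fun I => ?_
  simp only [mask]
  split_ifs
  · fun_prop
  · fun_prop

/-- The chi-square divergence between the laws of the observed data only charges the observed
entries. -/
lemma chiSqLe_mask {n : Fin 2 → ℕ} (S : Pattern d n) (a B a' B' : Tensor d) :
    ChiSqLe ((sampleLaw n (isoParam a B)).map (mask S))
      ((sampleLaw n (isoParam a' B')).map (mask S))
      (∑ k, ∑ i, ∑ I, if S k i I then
        ((isoParam a B).mean k I - (isoParam a' B').mean k I) ^ 2 else 0) := by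
  let f : (k : Fin 2) → (i : Fin (n k)) → Idx d → ℝ → ℝ := fun k i I x =>
    if S k i I then x else 0
  have hf : ∀ k i I, Measurable (f k i I) := fun k i I => by
    by_cases h : S k i I
    · simp only [f, h, if_true]
      exact measurable_id
    · simp only [f, h]
      exact measurable_const
  have hmap : ∀ a B : Tensor d, (sampleLaw n (isoParam a B)).map (mask S) =
      Measure.pi fun k => Measure.pi fun i => Measure.pi fun I =>
        (gaussianReal ((isoParam a B).mean k I) 1).map (f k i I) := by
    intro a B
    have h1 : mask S = fun (X : Sample d n) k => (fun (Y : Fin (n k) → Tensor d) i =>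
      (fun (Z : Tensor d) I => f k i I (Z I)) (Y i)) (X k) := rfl
    have hp : ∀ k i I, IsProbabilityMeasure
        ((gaussianReal ((isoParam a B).mean k I) 1).map (f k i I)) := fun k i I =>
      Measure.isProbabilityMeasure_map (hf k i I).aemeasurable
    have hm3 : ∀ k i, Measurable fun (Z : Tensor d) I => f k i I (Z I) := fun k i =>
      measurable_pi_lambda _ fun I => (hf k i I).comp (measurable_pi_apply I)
    have hm2 : ∀ k, Measurable fun (Y : Fin (n k) → Tensor d) i =>
        (fun (Z : Tensor d) I => f k i I (Z I)) (Y i) := fun k =>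
      measurable_pi_lambda _ fun i => (hm3 k i).comp (measurable_pi_apply i)
    have h3 : ∀ k i, ((isoParam a B).law k).map (fun (Z : Tensor d) I => f k i I (Z I)) =
        Measure.pi fun I => (gaussianReal ((isoParam a B).mean k I) 1).map (f k i I) := by
      intro k i
      rw [isoParam_law, Measure.pi_map_pi fun I => (hf k i I).aemeasurable]
    have h2 : ∀ k, (Measure.pi fun _ : Fin (n k) => (isoParam a B).law k).map
        (fun (Y : Fin (n k) → Tensor d) i => (fun (Z : Tensor d) I => f k i I (Z I)) (Y i)) =
        Measure.pi fun i => Measure.pi fun I =>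
          (gaussianReal ((isoParam a B).mean k I) 1).map (f k i I) := by
      intro k
      have : ∀ i, SigmaFinite (((isoParam a B).law k).map
          (fun (Z : Tensor d) I => f k i I (Z I))) := fun i => by rw [h3]; infer_instance
      rw [Measure.pi_map_pi fun i => (hm3 k i).aemeasurable]
      simp_rw [h3]
    have : ∀ k, SigmaFinite ((Measure.pi fun _ : Fin (n k) => (isoParam a B).law k).map
        (fun (Y : Fin (n k) → Tensor d) i => (fun (Z : Tensor d) I => f k i I (Z I)) (Y i))) :=
      fun k => by rw [h2]; infer_instance
    rw [sampleLaw, h1, Measure.pi_map_pi fun k => (hm2 k).aemeasurable]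
    simp_rw [h2]
  have hp : ∀ a B : Tensor d, ∀ k i I, IsProbabilityMeasure
      ((gaussianReal ((isoParam a B).mean k I) 1).map (f k i I)) := fun a B k i I =>
    Measure.isProbabilityMeasure_map (hf k i I).aemeasurable
  rw [hmap, hmap]
  refine ChiSqLe.pi fun k => ChiSqLe.pi fun i => ChiSqLe.pi fun I => ?_
  by_cases h : S k i I
  · simp only [f, h, if_true, Measure.map_id']
    exact chiSqLe_gaussianReal _ _
  · simp only [f, h, Bool.false_eq_true, if_false, Measure.map_const, measure_univ, one_smul]
    exact chiSqLe_refl _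

/-- The missingness pattern in which the first `n₀` observations of each class are complete and
nothing else is observed. -/
def initialPattern (d : Fin M → ℕ) (n : Fin 2 → ℕ) (n₀ : ℕ) : Pattern d n :=
  fun _ i _ => decide (i.val < n₀)

lemma card_filter_initial {m n₀ : ℕ} (h : n₀ ≤ m) :
    (Finset.univ.filter fun i : Fin m => i.val < n₀).card = n₀ := by
  rw [Fin.card_filter_val_lt, min_eq_right h]

lemma dirac_initialPattern_mem (hM : 1 ≤ M) (hd : ∀ m, 1 ≤ d m) {n : Fin 2 → ℕ} {n₀ : ℕ}
    (hn : ∀ k, n₀ ≤ n k) {κ₁ κ₂ κ₃ : ℝ} (hκ₁ : κ₁ ≤ 1) (hκ₂ : 2 ≤ κ₂) :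
    Measure.dirac (initialPattern d n n₀) ∈ missingLaws d n n₀ κ₁ κ₂ κ₃ := by
  have : Nonempty (Fin M) := ⟨⟨0, hM⟩⟩
  have : ∀ m, Nonempty (Fin (d m)) := fun m => ⟨⟨0, hd m⟩⟩
  have h1 : ∀ k I J, pairCount (initialPattern d n n₀) k I J = n₀ := fun k I J => by
    simp [pairCount, initialPattern, card_filter_initial (hn k)]
  have h2 : effSize (initialPattern d n n₀) = 2 * n₀ := by
    simp [effSize, h1, ciInf_const]
  have h3 : ∀ k, effSizeClass (initialPattern d n n₀) k = n₀ := fun k => by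
    simp [effSizeClass, h1, ciInf_const]
  have hn0 : (0 : ℝ) ≤ n₀ := n₀.cast_nonneg
  refine ⟨inferInstance, ?_⟩
  rw [Measure.dirac_apply_of_mem]
  · rw [← ENNReal.ofReal_one]
    refine ENNReal.ofReal_le_ofReal ?_
    have : (0 : ℝ) ≤ ((∏ m, d m : ℕ) : ℝ) ^ (-κ₃) := by positivity
    linarith
  · refine ⟨?_, ?_, fun k => ?_⟩
    · rw [h2]; push_cast; nlinarith
    · rw [h2]; push_cast; nlinarith
    · rw [h3]; nlinarith

lemma measurable_risk {n : Fin 2 → ℕ} (w : Fin 2 → ℝ) (δ : Classifier d n) (S : Pattern d n)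
    (a B : Tensor d) : Measurable fun y : Sample d n => (isoParam a B).risk w (δ.toFun S y) := by
  simp only [Param.risk]
  refine Finset.measurable_sum _ fun k _ => Measurable.const_mul ?_ _
  have hm : Measurable fun x : Sample d n × Tensor d => δ.toFun S x.1 x.2 :=
    δ.measurable'.comp (measurable_const.prodMk measurable_id)
  have hs : MeasurableSet {x : Sample d n × Tensor d | δ.toFun S x.1 x.2 ≠ k} :=
    (hm (measurableSet_singleton k)).compl
  exact (measurable_measure_prodMk_left (ν := (isoParam a B).law k) hs).ennreal_toReal

/-- The minimax probability is large when there is a grid of parameters, with identity covariances,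
which cannot be told apart coordinate by coordinate, and on which no rule has a small excess risk
at two distant points. -/
theorem le_minimaxProb {r : Fin M → ℕ} {n : Fin 2 → ℕ} {n₀ : ℕ} {C₀ κ₁ κ₂ κ₃ : ℝ}
    {w : Fin 2 → ℝ} {Δ t α : ℝ} (hM : 1 ≤ M) (hd : ∀ m, 1 ≤ d m) (hn : ∀ k, n₀ ≤ n k)
    (hκ₁ : κ₁ ≤ 1) (hκ₂ : 2 ≤ κ₂)
    {J : Type*} [Fintype J] [DecidableEq J] [Nonempty J] {q : ℕ} [NeZero q]
    (a B : (J → Fin q) → Tensor d)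
    (hmem : ∀ v, isoParam (a v) (B v) ∈ {θ ∈ paramSpace d r C₀ | θ.snr = Δ})
    {c δ : ℝ} (hδ : 0 < δ)
    (hclose : ∀ v j x, (n₀ : ℝ) * ∑ k, ∑ I, ((isoParam (a (Function.update v j x))
      (B (Function.update v j x))).mean k I - (isoParam (a v) (B v)).mean k I) ^ 2 ≤ c)
    (hα : 2 * (1 / q + (δ / 2 + (Real.exp c - 1) / (2 * δ))) ≤ α)
    {ρ : ℝ} (hρ : 0 < ρ) (ht : 4 * t ≤ ρ * Fintype.card J)
    (hsep : ∀ v v' (rule : Tensor d → Fin 2), v ≠ v' → Measurable rule →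
      ρ * hammingDist v v' ≤
        ((isoParam (a v) (B v)).risk w rule - (isoParam (a v) (B v)).optRisk w) +
        ((isoParam (a v') (B v')).risk w rule - (isoParam (a v') (B v')).optRisk w)) :
    ENNReal.ofReal (1 - α) ≤ minimaxProb d r n n₀ C₀ κ₁ κ₂ κ₃ w Δ t := by
  refine le_iInf fun δc => ?_
  set S := initialPattern d n n₀ with hS
  let P : (J → Fin q) → Measure (Sample d n) := fun v =>
    (sampleLaw n (isoParam (a v) (B v))).map (mask S)
  have hPp : ∀ v, IsProbabilityMeasure (P v) := fun v =>
    Measure.isProbabilityMeasure_map (measurable_mask S).aemeasurable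
  let A : (J → Fin q) → Set (Sample d n) := fun v =>
    {y | (isoParam (a v) (B v)).risk w (δc.toFun S y) - (isoParam (a v) (B v)).optRisk w < t}
  have hA : ∀ v, MeasurableSet (A v) := fun v =>
    measurableSet_lt ((measurable_risk w δc S _ _).sub_const _) measurable_const
  have hP : ∀ v j x, ChiSqLe (P (Function.update v j x)) (P v) c := by
    intro v j x
    obtain ⟨L, h1, h2, h3, h4, h5⟩ := chiSqLe_mask S (a (Function.update v j x))
      (B (Function.update v j x)) (a v) (B v)
    refine ⟨L, h1, h2, h3, h4.trans (Real.exp_le_exp.2 (le_trans (le_of_eq ?_) (hclose v j x))), h5⟩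
    rw [Finset.mul_sum]
    refine Finset.sum_congr rfl fun k _ => ?_
    simp only [hS, initialPattern, decide_eq_true_eq]
    have : ∀ i : Fin (n k), (∑ I, if i.val < n₀ then
        ((isoParam (a (Function.update v j x)) (B (Function.update v j x))).mean k I -
          (isoParam (a v) (B v)).mean k I) ^ 2 else 0) =
        if i.val < n₀ then ∑ I,
        ((isoParam (a (Function.update v j x)) (B (Function.update v j x))).mean k I -
          (isoParam (a v) (B v)).mean k I) ^ 2 else 0 := fun i => by
      split_ifs <;> simp
    simp_rw [this]
    rw [← Finset.sum_filter, Finset.sum_const, card_filter_initial (hn k), nsmul_eq_mul]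
  have hAA : ∀ y v v', y ∈ A v → y ∈ A v' → 2 * hammingDist v v' ≤ Fintype.card J := by
    intro y v v' hv hv'
    by_cases hvv : v = v'
    · simp [hvv]
    have hm : Measurable (δc.toFun S y) :=
      δc.measurable'.comp (measurable_const.prodMk (measurable_const.prodMk measurable_id))
    have h1 := hsep v v' _ hvv hm
    have h2 : (isoParam (a v) (B v)).risk w (δc.toFun S y) -
      (isoParam (a v) (B v)).optRisk w < t := hv
    have h3 : (isoParam (a v') (B v')).risk w (δc.toFun S y) -
      (isoParam (a v') (B v')).optRisk w < t := hv'
    have h4 : ρ * (2 * hammingDist v v' : ℝ) ≤ ρ * Fintype.card J := by linarith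
    exact_mod_cast le_of_mul_le_mul_left h4 hρ
  obtain ⟨v, hv⟩ := exists_measureReal_le P hδ hP A hA hAA
  refine le_trans ?_ (le_iSup₂_of_le (isoParam (a v) (B v)) (hmem v)
    (le_iSup₂_of_le (Measure.dirac S) (dirac_initialPattern_mem hM hd hn hκ₁ hκ₂) le_rfl))
  rw [Measure.dirac_prod]
  refine le_trans ?_ (Measure.le_map_apply (by fun_prop) _)
  have h1 : (P v) (A v)ᶜ = (sampleLaw n (isoParam (a v) (B v)))
      (Prod.mk S ⁻¹' {x | t ≤ excessRisk w (isoParam (a v) (B v)) δc x.1 x.2}) := by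
    rw [Measure.map_apply (measurable_mask S) (hA v).compl]
    congr 1
    ext X
    simp [A, excessRisk]
  rw [← h1, ← ofReal_measureReal, probReal_compl_eq_one_sub (hA v)]
  exact ENNReal.ofReal_le_ofReal (by linarith)

end Data

/-! ### The excess risk of a fixed rule -/

lemma measureReal_withDensity_ofReal {Ω : Type*} [MeasurableSpace Ω] {Q : Measure Ω} {L : Ω → ℝ}
    (hL : Measurable L) (h0 : ∀ x, 0 ≤ L x) {s : Set Ω} (hs : MeasurableSet s) :
    (Q.withDensity fun x => ENNReal.ofReal (L x)).real s = ∫ x in s, L x ∂Q := by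
  rw [integral_eq_lintegral_of_nonneg_ae (Eventually.of_forall h0) hL.aestronglyMeasurable,
    Measure.real, withDensity_apply _ hs]

lemma map_standardize_gaussianPi {ι : Type*} [Fintype ι] (μ b : ι → ℝ) {σ : ℝ} (hσ : 0 < σ)
    (hb : b ⬝ᵥ b = σ ^ 2) :
    (gaussianPi μ).map (fun z => σ⁻¹ * (b ⬝ᵥ z - b ⬝ᵥ μ)) = gaussianReal 0 1 := by
  have h1 : (fun z : ι → ℝ => σ⁻¹ * (b ⬝ᵥ z - b ⬝ᵥ μ)) =
      (fun x => σ⁻¹ * x) ∘ (fun x => x - b ⬝ᵥ μ) ∘ fun z => b ⬝ᵥ z := rfl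
  have hm : Measurable fun z : ι → ℝ => b ⬝ᵥ z := by
    simp only [dotProduct]; fun_prop
  rw [h1, ← Measure.map_map (by fun_prop) (by fun_prop), ← Measure.map_map (by fun_prop) hm,
    map_dotProduct_gaussianPi, gaussianReal_map_sub_const, gaussianReal_map_const_mul, hb]
  congr 1
  · simp
  · ext
    simp [Real.coe_toNNReal _ (sq_nonneg σ), hσ.ne']

lemma measurable_dotProduct_left {ι : Type*} [Fintype ι] (b : ι → ℝ) :
    Measurable fun z : ι → ℝ => b ⬝ᵥ z := by
  simp only [dotProduct]; fun_prop

lemma integrable_dotProduct_gaussianPi {ι : Type*} [Fintype ι] (μ b : ι → ℝ) :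
    Integrable (fun z => b ⬝ᵥ z) (gaussianPi μ) :=
  (hasGaussianLaw_dotProduct_pair μ b b).fst.integrable

lemma gaussianReal_Ioi (c : ℝ) :
    (gaussianReal 0 1).real (Set.Ioi c) = cdf (gaussianReal 0 1) (-c) := by
  have : NullSingletonClass (gaussianReal 0 1) := nullSingletonClass_gaussianReal one_ne_zero
  have h : (gaussianReal 0 1).map (fun x => -x) = gaussianReal 0 1 := by
    simp [gaussianReal_map_neg]
  rw [cdf_eq_real, measureReal_congr Ioi_ae_eq_Ici]
  conv_lhs => rw [← h]
  rw [map_measureReal_apply measurable_neg measurableSet_Ici]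
  simp

section Risk

variable {M : ℕ} {d : Fin M → ℕ}

/-- The log-likelihood ratio of the two classes at `z`, including the log ratio of the prior
weights, for the parameter `isoParam a B`. -/
def logRatio (w : Fin 2 → ℝ) (a B z : Tensor d) : ℝ := B ⬝ᵥ (z - a) + Real.log (w 1 / w 0)

lemma measurable_logRatio (w : Fin 2 → ℝ) (a B : Tensor d) : Measurable (logRatio w a B) := by
  have : logRatio w a B = fun z => B ⬝ᵥ z - B ⬝ᵥ a + Real.log (w 1 / w 0) := by
    funext z; rw [logRatio, dotProduct_sub]
  rw [this]
  exact ((measurable_dotProduct_left B).sub_const _).add_const _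

lemma integrable_logRatio (w : Fin 2 → ℝ) (a B μ : Tensor d) :
    Integrable (logRatio w a B) (gaussianPi μ) := by
  have : logRatio w a B = fun z => B ⬝ᵥ z - B ⬝ᵥ a + Real.log (w 1 / w 0) := by
    funext z; rw [logRatio, dotProduct_sub]
  rw [this]
  exact ((integrable_dotProduct_gaussianPi μ B).sub (integrable_const _)).add (integrable_const _)

/-- The cost of deciding for class `i` when the log-likelihood ratio is `t`, relative to the
geometric mean of the two weighted densities. -/
def decisionCost (i : Fin 2) (t : ℝ) : ℝ := if i = 1 then Real.exp (-t / 2) else Real.exp (t / 2)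

lemma weighted_density_zero {w : Fin 2 → ℝ} (hw : ∀ k, 0 < w k) (x e : ℝ) :
    w 0 * Real.exp (-(1 / 2) * x - e) =
      √(w 0 * w 1) * Real.exp (-e) * Real.exp (-(x + Real.log (w 1 / w 0)) / 2) := by
  have h0 := hw 0
  have h1 := hw 1
  have h2 : √(w 0 * w 1) = w 0 * Real.exp (Real.log (w 1 / w 0) / 2) := by
    symm
    rw [← Real.sqrt_sq (by positivity : 0 ≤ w 0 * Real.exp (Real.log (w 1 / w 0) / 2))]
    congr 1
    have : Real.exp (Real.log (w 1 / w 0) / 2) * Real.exp (Real.log (w 1 / w 0) / 2) =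
        w 1 / w 0 := by
      rw [← Real.exp_add, add_halves, Real.exp_log (by positivity)]
    calc (w 0 * Real.exp (Real.log (w 1 / w 0) / 2)) ^ 2 =
          w 0 * w 0 * (Real.exp (Real.log (w 1 / w 0) / 2) *
          Real.exp (Real.log (w 1 / w 0) / 2)) := by ring
      _ = _ := by rw [this]; field_simp
  rw [h2, mul_assoc, mul_assoc, ← Real.exp_add, ← Real.exp_add]
  congr 2
  ring

lemma weighted_density_one {w : Fin 2 → ℝ} (hw : ∀ k, 0 < w k) (x e : ℝ) :
    w 1 * Real.exp (1 / 2 * x - e) =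
      √(w 0 * w 1) * Real.exp (-e) * Real.exp ((x + Real.log (w 1 / w 0)) / 2) := by
  have h := weighted_density_zero (w := fun k => w (1 - k)) (fun k => hw _) (-x) e
  simp only [sub_zero, sub_self] at h
  rw [show (1 / 2 * x - e) = (-(1 / 2) * -x - e) by ring, h, mul_comm (w 1) (w 0),
    ← inv_div (w 1) (w 0), Real.log_inv]
  congr 2
  ring

lemma integrable_weighted_density {w : Fin 2 → ℝ} (a B : Tensor d) :
    Integrable (fun z => Real.exp (-logRatio w a B z / 2)) (gaussianPi a) ∧
      Integrable (fun z => Real.exp (logRatio w a B z / 2)) (gaussianPi a) := by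
  have key : ∀ b : Tensor d, Integrable (fun z => Real.exp (b ⬝ᵥ (z - a))) (gaussianPi a) := by
    intro b
    have hm : Measurable fun z : Tensor d => b ⬝ᵥ (z - a) := by
      simp only [dotProduct, Pi.sub_apply]; fun_prop
    have h := (integrable_of_withDensity (P := gaussianPi (a + b)) (Q := gaussianPi a)
      (L := fun x => Real.exp ((a + b - a) ⬝ᵥ (x - a) - (a + b - a) ⬝ᵥ (a + b - a) / 2))
      (by simp only [add_sub_cancel_left]; fun_prop) (fun x => (Real.exp_pos _).le)
      (gaussianPi_eq_withDensity _ _)).1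
    simp only [add_sub_cancel_left] at h
    refine (h.mul_const (Real.exp (b ⬝ᵥ b / 2))).congr (Eventually.of_forall fun z => ?_)
    simp only
    rw [← Real.exp_add]
    ring_nf
  constructor
  · refine ((key (-(1 / 2 : ℝ) • B)).const_mul (Real.exp (-Real.log (w 1 / w 0) / 2))).congr
      (Eventually.of_forall fun z => ?_)
    simp only [logRatio]
    rw [← Real.exp_add, smul_dotProduct, smul_eq_mul]
    ring_nf
  · refine ((key ((1 / 2 : ℝ) • B)).const_mul (Real.exp (Real.log (w 1 / w 0) / 2))).congr
      (Eventually.of_forall fun z => ?_)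
    simp only [logRatio]
    rw [← Real.exp_add, smul_dotProduct, smul_eq_mul]
    ring_nf

lemma integrable_decisionCost {w : Fin 2 → ℝ} (a B : Tensor d) {rule : Tensor d → Fin 2}
    (hr : Measurable rule) :
    Integrable (fun z => decisionCost (rule z) (logRatio w a B z)) (gaussianPi a) := by
  obtain ⟨h1, h2⟩ := integrable_weighted_density (w := w) a B
  have hs : MeasurableSet {z | rule z = 1} := hr (measurableSet_singleton 1)
  classical
  refine (Integrable.piecewise hs h1.integrableOn h2.integrableOn).congr
    (Eventually.of_forall fun z => ?_)
  by_cases hz : rule z = 1 <;> simp [decisionCost, Set.piecewise, hz]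

/-- The risk as an integral against the Gaussian law centred at the midpoint of the means. -/
lemma risk_eq {w : Fin 2 → ℝ} (hw : ∀ k, 0 < w k) (a B : Tensor d) {rule : Tensor d → Fin 2}
    (hr : Measurable rule) :
    (isoParam a B).risk w rule = √(w 0 * w 1) * Real.exp (-(B ⬝ᵥ B / 8)) *
      ∫ z, decisionCost (rule z) (logRatio w a B z) ∂gaussianPi a := by
  obtain ⟨h1, h2⟩ := integrable_weighted_density (w := w) a B
  have hs : MeasurableSet {z | rule z = 1} := hr (measurableSet_singleton 1)
  have hlaw : ∀ (c : ℝ) (s : Set (Tensor d)), MeasurableSet s →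
      (gaussianPi (a + c • B)).real s =
        ∫ z in s, Real.exp (c * (B ⬝ᵥ (z - a)) - c ^ 2 * (B ⬝ᵥ B) / 2) ∂gaussianPi a := by
    intro c s hs
    have hm : Measurable fun z : Tensor d => B ⬝ᵥ (z - a) := by
      simp only [dotProduct, Pi.sub_apply]; fun_prop
    rw [gaussianPi_eq_withDensity (a + c • B) a]
    simp only [add_sub_cancel_left, smul_dotProduct, dotProduct_smul, smul_eq_mul]
    rw [measureReal_withDensity_ofReal (by fun_prop) (fun x => (Real.exp_pos _).le) hs]
    refine integral_congr_ae (Eventually.of_forall fun z => ?_)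
    simp only
    ring_nf
  have e0 : (isoParam a B).law 0 = gaussianPi (a + (-(1 / 2 : ℝ)) • B) := by
    rw [isoParam_law]
    congr 1
    simp [isoParam, sub_eq_add_neg]
  have e1 : (isoParam a B).law 1 = gaussianPi (a + (1 / 2 : ℝ) • B) := by
    rw [isoParam_law]
    rfl
  have s0 : {z | rule z ≠ 0} = {z | rule z = 1} := by
    ext z
    simp only [Set.mem_ofPred_eq]
    generalize rule z = i
    fin_cases i <;> simp
  have s1 : {z | rule z ≠ 1} = {z | rule z = 1}ᶜ := rfl
  rw [Param.risk, Fin.sum_univ_two, e0, e1, s0, s1, hlaw _ _ hs, hlaw _ _ hs.compl,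
    ← integral_const_mul, ← integral_const_mul, ← integral_const_mul,
    ← integral_add_compl hs ((integrable_decisionCost a B hr).const_mul _)]
  congr 1
  · refine setIntegral_congr_fun hs fun z hz => ?_
    have hz' : rule z = 1 := hz
    simp only [decisionCost, hz', if_true, logRatio]
    rw [← weighted_density_zero hw]
    ring_nf
  · refine setIntegral_congr_fun hs.compl fun z hz => ?_
    have hz' : rule z ≠ 1 := hz
    simp only [decisionCost, hz', if_false, logRatio]
    rw [← weighted_density_one hw]
    ring_nf

/-- The Bayes rule: decide for the class with the larger weighted density. -/
def bayesRule (w : Fin 2 → ℝ) (a B z : Tensor d) : Fin 2 := if 0 < logRatio w a B z then 1 else 0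

lemma measurable_bayesRule (w : Fin 2 → ℝ) (a B : Tensor d) : Measurable (bayesRule w a B) :=
  Measurable.ite (measurableSet_lt measurable_const (measurable_logRatio w a B))
    measurable_const measurable_const

lemma optRisk_eq_risk_bayesRule {w : Fin 2 → ℝ} (a : Tensor d) {B : Tensor d} {Δ : ℝ}
    (hΔ : 0 < Δ) (hB : B ⬝ᵥ B = Δ ^ 2) :
    (isoParam a B).optRisk w = (isoParam a B).risk w (bayesRule w a B) := by
  have hsnr : (isoParam a B).snr = Δ := by
    rw [isoParam_snr, hB, Real.sqrt_sq hΔ.le]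
  have hm : ∀ k, Measurable fun z : Tensor d =>
      Δ⁻¹ * (B ⬝ᵥ z - B ⬝ᵥ (isoParam a B).mean k) := fun k =>
    ((measurable_dotProduct_left B).sub_const _).const_mul _
  have hn : ∀ k, (gaussianPi ((isoParam a B).mean k)).map _ = gaussianReal 0 1 := fun k =>
    map_standardize_gaussianPi ((isoParam a B).mean k) B hΔ hB
  have m0 : B ⬝ᵥ (isoParam a B).mean 0 = B ⬝ᵥ a - Δ ^ 2 / 2 := by
    simp only [isoParam, Matrix.cons_val_zero, dotProduct_sub, dotProduct_smul, hB, smul_eq_mul]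
    ring
  have m1 : B ⬝ᵥ (isoParam a B).mean 1 = B ⬝ᵥ a + Δ ^ 2 / 2 := by
    simp [isoParam, dotProduct_add, dotProduct_smul, hB]
    ring
  have h0 : ((isoParam a B).law 0).real {z | bayesRule w a B z ≠ 0} =
      cdf (gaussianReal 0 1) (Δ⁻¹ * Real.log (w 1 / w 0) - Δ / 2) := by
    have : {z | bayesRule w a B z ≠ 0} = (fun z : Tensor d =>
        Δ⁻¹ * (B ⬝ᵥ z - B ⬝ᵥ (isoParam a B).mean 0)) ⁻¹'
          Set.Ioi (-(Δ⁻¹ * Real.log (w 1 / w 0) - Δ / 2)) := by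
      ext z
      have : -(Δ⁻¹ * Real.log (w 1 / w 0) - Δ / 2) <
          Δ⁻¹ * (B ⬝ᵥ z - B ⬝ᵥ (isoParam a B).mean 0) ↔ 0 < logRatio w a B z := by
        have e : Δ⁻¹ * (B ⬝ᵥ z - B ⬝ᵥ (isoParam a B).mean 0) -
            -(Δ⁻¹ * Real.log (w 1 / w 0) - Δ / 2) = Δ⁻¹ * logRatio w a B z := by
          rw [logRatio, dotProduct_sub, m0]
          field_simp
          ring
        rw [← sub_pos, e, mul_pos_iff_of_pos_left (inv_pos.2 hΔ)]
      rw [Set.mem_preimage, Set.mem_Ioi, this]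
      simp [bayesRule]
    rw [this, isoParam_law, ← map_measureReal_apply (hm 0) measurableSet_Ioi, hn, gaussianReal_Ioi,
      neg_neg]
  have h1 : ((isoParam a B).law 1).real {z | bayesRule w a B z ≠ 1} =
      1 - cdf (gaussianReal 0 1) (Δ⁻¹ * Real.log (w 1 / w 0) + Δ / 2) := by
    have : {z | bayesRule w a B z ≠ 1} = (fun z : Tensor d =>
        Δ⁻¹ * (B ⬝ᵥ z - B ⬝ᵥ (isoParam a B).mean 1)) ⁻¹'
          (Set.Ioi (-(Δ⁻¹ * Real.log (w 1 / w 0) + Δ / 2)))ᶜ := by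
      ext z
      have : -(Δ⁻¹ * Real.log (w 1 / w 0) + Δ / 2) <
          Δ⁻¹ * (B ⬝ᵥ z - B ⬝ᵥ (isoParam a B).mean 1) ↔ 0 < logRatio w a B z := by
        have e : Δ⁻¹ * (B ⬝ᵥ z - B ⬝ᵥ (isoParam a B).mean 1) -
            -(Δ⁻¹ * Real.log (w 1 / w 0) + Δ / 2) = Δ⁻¹ * logRatio w a B z := by
          rw [logRatio, dotProduct_sub, m1]
          field_simp
          ring
        rw [← sub_pos, e, mul_pos_iff_of_pos_left (inv_pos.2 hΔ)]
      rw [Set.mem_preimage, Set.mem_compl_iff, Set.mem_Ioi, this]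
      simp [bayesRule]
    rw [this, isoParam_law, ← map_measureReal_apply (hm 1) measurableSet_Ioi.compl, hn,
      probReal_compl_eq_one_sub measurableSet_Ioi, gaussianReal_Ioi, neg_neg]
  rw [Param.optRisk, Param.risk, Fin.sum_univ_two, h0, h1, hsnr]

/-- The loss of deciding for class `i`, bounded below linearly in the log-likelihood ratio. -/
def linearLoss (i : Fin 2) (t : ℝ) : ℝ := if i = 1 then max (-t) 0 else max t 0

lemma linearLoss_nonneg (i : Fin 2) (t : ℝ) : 0 ≤ linearLoss i t := by
  rw [linearLoss]; split_ifs <;> exact le_max_right _ _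

/-- This is `2 sinh x ≥ 2 x`. -/
lemma linearLoss_le (i : Fin 2) (t : ℝ) :
    linearLoss i t ≤ decisionCost i t - decisionCost (if 0 < t then 1 else 0) t := by
  have key : ∀ x : ℝ, 0 ≤ x → x ≤ Real.exp (x / 2) - Real.exp (-x / 2) := by
    intro x hx
    have h := Real.self_le_sinh_iff.2 (by linarith : 0 ≤ x / 2)
    rw [Real.sinh_eq] at h
    rw [neg_div]
    linarith
  by_cases ht : 0 < t
  · by_cases hi : i = 1
    · simp [linearLoss, decisionCost, ht, hi, ht.le]
    · simpa [linearLoss, decisionCost, ht, hi, ht.le] using key t ht.le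
  · have ht' : t ≤ 0 := not_lt.1 ht
    by_cases hi : i = 1
    · have := key (-t) (by linarith)
      simpa [linearLoss, decisionCost, ht, hi, ht'] using this
    · simp [linearLoss, decisionCost, ht, hi, ht']

lemma integrable_linearLoss {w : Fin 2 → ℝ} (a B μ : Tensor d) {rule : Tensor d → Fin 2}
    (hr : Measurable rule) :
    Integrable (fun z => linearLoss (rule z) (logRatio w a B z)) (gaussianPi μ) := by
  have h := integrable_logRatio w a B μ
  have hs : MeasurableSet {z | rule z = 1} := hr (measurableSet_singleton 1)
  classical
  refine (Integrable.piecewise hs h.neg.pos_part.integrableOn h.pos_part.integrableOn).congr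
    (Eventually.of_forall fun z => ?_)
  by_cases hz : rule z = 1 <;> simp [linearLoss, Set.piecewise, hz]

/-- Localization of the excess risk to an event `E` on which the Gaussian law centred at `a` has
density at least `K` with respect to the standard one. -/
lemma le_excess_risk {w : Fin 2 → ℝ} (hw : ∀ k, 0 < w k) (a : Tensor d) {B : Tensor d} {Δ : ℝ}
    (hΔ : 0 < Δ) (hB : B ⬝ᵥ B = Δ ^ 2) {rule : Tensor d → Fin 2} (hr : Measurable rule)
    {E : Set (Tensor d)} (hE : MeasurableSet E) {K : ℝ} (hK : 0 ≤ K)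
    (hEK : ∀ z ∈ E, K ≤ Real.exp (a ⬝ᵥ z - a ⬝ᵥ a / 2)) :
    √(w 0 * w 1) * Real.exp (-(Δ ^ 2 / 8)) *
        (K * ∫ z in E, linearLoss (rule z) (logRatio w a B z) ∂gaussianPi 0) ≤
      (isoParam a B).risk w rule - (isoParam a B).optRisk w := by
  rw [optRisk_eq_risk_bayesRule a hΔ hB, risk_eq hw a B hr,
    risk_eq hw a B (measurable_bayesRule w a B), ← mul_sub, hB, ← integral_sub
      (integrable_decisionCost a B hr) (integrable_decisionCost a B (measurable_bayesRule w a B))]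
  refine mul_le_mul_of_nonneg_left ?_ (by positivity)
  have hI := integrable_linearLoss (w := w) a B a hr
  have h1 : ∫ z, linearLoss (rule z) (logRatio w a B z) ∂gaussianPi a ≤
      ∫ z, (decisionCost (rule z) (logRatio w a B z) -
        decisionCost (bayesRule w a B z) (logRatio w a B z)) ∂gaussianPi a :=
    integral_mono hI ((integrable_decisionCost a B hr).sub
      (integrable_decisionCost a B (measurable_bayesRule w a B))) fun z => linearLoss_le _ _
  refine le_trans ?_ h1
  have h2 : ENNReal.ofReal K • (gaussianPi (0 : Tensor d)).restrict E ≤ gaussianPi a := by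
    refine Measure.le_iff.2 fun s hs => ?_
    rw [gaussianPi_eq_withDensity a 0, withDensity_apply _ hs, Measure.smul_apply,
      Measure.restrict_apply hs, smul_eq_mul, ← setLIntegral_const]
    refine (setLIntegral_mono' (hs.inter hE) fun z hz => ?_).trans
      (lintegral_mono_set Set.inter_subset_left)
    simpa using ENNReal.ofReal_le_ofReal (hEK z hz.2)
  have h3 := integral_mono_measure h2
    (Eventually.of_forall fun z => linearLoss_nonneg (rule z) (logRatio w a B z)) hI
  rwa [integral_smul_measure, ENNReal.toReal_ofReal hK, smul_eq_mul] at h3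

lemma linearLoss_add_linearLoss {s x η : ℝ} (hs : |s| ≤ η / 2) (hx : η ≤ |x|) (i : Fin 2) :
    η / 2 ≤ linearLoss i (s + x) + linearLoss i (s - x) := by
  obtain ⟨h1, h2⟩ := abs_le.1 hs
  have a1 := le_max_left (-(s + x)) 0
  have a2 := le_max_right (-(s + x)) 0
  have a3 := le_max_left (-(s - x)) 0
  have a4 := le_max_right (-(s - x)) 0
  have b1 := le_max_left (s + x) 0
  have b2 := le_max_right (s + x) 0
  have b3 := le_max_left (s - x) 0
  have b4 := le_max_right (s - x) 0
  simp only [linearLoss]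
  rcases le_abs.1 hx with h | h <;> split_ifs <;> linarith

/-- If on an event `E` the two log-likelihood ratios have opposite signs and absolute value at least
`η / 2`, then every rule errs under one of the two parameters. -/
lemma le_excess_risk_add {w : Fin 2 → ℝ} (hw : ∀ k, 0 < w k) {a a' B B' : Tensor d} {Δ : ℝ}
    (hΔ : 0 < Δ) (hB : B ⬝ᵥ B = Δ ^ 2) (hB' : B' ⬝ᵥ B' = Δ ^ 2) {rule : Tensor d → Fin 2}
    (hr : Measurable rule) {E : Set (Tensor d)} (hE : MeasurableSet E) {K η : ℝ} (hK : 0 ≤ K)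
    (hEK : ∀ z ∈ E, K ≤ Real.exp (a ⬝ᵥ z - a ⬝ᵥ a / 2))
    (hEK' : ∀ z ∈ E, K ≤ Real.exp (a' ⬝ᵥ z - a' ⬝ᵥ a' / 2))
    (hη : ∀ z ∈ E, ∃ s x, |s| ≤ η / 2 ∧ η ≤ |x| ∧ logRatio w a B z = s + x ∧
      logRatio w a' B' z = s - x) :
    √(w 0 * w 1) * Real.exp (-(Δ ^ 2 / 8)) * (K * (η / 2 * (gaussianPi 0).real E)) ≤
      ((isoParam a B).risk w rule - (isoParam a B).optRisk w) +
      ((isoParam a' B').risk w rule - (isoParam a' B').optRisk w) := by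
  refine le_trans ?_ (add_le_add (le_excess_risk hw a hΔ hB hr hE hK hEK)
    (le_excess_risk hw a' hΔ hB' hr hE hK hEK'))
  rw [← mul_add, ← mul_add]
  refine mul_le_mul_of_nonneg_left (mul_le_mul_of_nonneg_left ?_ hK) (by positivity)
  have hI := (integrable_linearLoss (w := w) a B 0 hr).integrableOn (s := E)
  have hI' := (integrable_linearLoss (w := w) a' B' 0 hr).integrableOn (s := E)
  rw [← integral_add hI hI']
  have h := setIntegral_mono_on (integrableOn_const (C := η / 2) (measure_ne_top _ _)) (hI.add hI')
    hE fun z hz => ?_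
  · simpa [mul_comm] using h
  · obtain ⟨s, x, hs, hx, e1, e2⟩ := hη z hz
    simp only [Pi.add_apply]
    rw [e1, e2]
    exact linearLoss_add_linearLoss hs hx _

/-- The standard normal probability of `|x| ≥ 1`. -/
def normalTail : ℝ := (gaussianReal 0 1).real {x | 1 ≤ |x|}

lemma normalTail_pos : 0 < normalTail := by
  have h := le_gaussianReal_Icc (a := 1) (b := 2) (R := 2) (by norm_num) (by norm_num) le_rfl
  have h2 : (gaussianReal 0 1).real (Set.Icc 1 2) ≤ normalTail :=
    measureReal_mono fun x hx => hx.1.trans (le_abs_self x)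
  have : 0 < (√(2 * Real.pi))⁻¹ * Real.exp (-2 ^ 2 / 2) := by positivity
  linarith

/-- The factor of the separation bounds that is neither the Gaussian factor `exp (-Δ² / 8)` nor the
squared distance of the parameters; it decays at most exponentially in `Δ`, for large `Δ`. -/
def sepFactor (w : Fin 2 → ℝ) (Δ : ℝ) : ℝ :=
  normalTail * (√(2 * Real.pi))⁻¹ / 8 * Real.exp (-(Δ + Δ⁻¹ + (2 * |Real.log (w 1 / w 0)| / Δ + 1) +
    (2 * |Real.log (w 1 / w 0)| / Δ + 1) ^ 2 / 2))

lemma sepFactor_pos (w : Fin 2 → ℝ) (Δ : ℝ) : 0 < sepFactor w Δ := by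
  have := normalTail_pos
  rw [sepFactor]; positivity

/-- Separation of two discriminant directions. The half sum and the half difference of `B` and `B'`
are orthogonal, hence give independent Gaussian variables. -/
theorem separation_direction {w : Fin 2 → ℝ} (hw : ∀ k, 0 < w k) {B B' : Tensor d} {Δ : ℝ}
    (hΔ : 0 < Δ) (hB : B ⬝ᵥ B = Δ ^ 2) (hB' : B' ⬝ᵥ B' = Δ ^ 2) (hne : B ≠ B')
    (hsum : Δ ^ 2 ≤ (B + B') ⬝ᵥ (B + B')) {rule : Tensor d → Fin 2} (hr : Measurable rule) :
    √(w 0 * w 1) * Real.exp (-(Δ ^ 2 / 8)) * sepFactor w Δ * ((B - B') ⬝ᵥ (B - B')) ≤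
      ((isoParam 0 B).risk w rule - (isoParam 0 B).optRisk w) +
      ((isoParam 0 B').risk w rule - (isoParam 0 B').optRisk w) := by
  set ℓ := Real.log (w 1 / w 0) with hℓ
  set b : Tensor d := (1 / 2 : ℝ) • (B - B') with hb
  set c : Tensor d := (1 / 2 : ℝ) • (B + B') with hc
  have hcomm : B' ⬝ᵥ B = B ⬝ᵥ B' := dotProduct_comm _ _
  have hbb : b ⬝ᵥ b = (B - B') ⬝ᵥ (B - B') / 4 := by
    simp only [hb, smul_dotProduct, dotProduct_smul, smul_eq_mul]; ring
  have hcc : c ⬝ᵥ c = (B + B') ⬝ᵥ (B + B') / 4 := by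
    simp only [hc, smul_dotProduct, dotProduct_smul, smul_eq_mul]; ring
  have hbc : b ⬝ᵥ c = 0 := by
    simp only [hb, hc, smul_dotProduct, dotProduct_smul, smul_eq_mul, sub_dotProduct,
      dotProduct_add, hB, hB', hcomm]
    ring
  have hpar : b ⬝ᵥ b + c ⬝ᵥ c = Δ ^ 2 := by
    rw [hbb, hcc]
    simp only [sub_dotProduct, dotProduct_sub, add_dotProduct, dotProduct_add, hB, hB', hcomm]
    ring
  have hb0 : 0 < b ⬝ᵥ b := by
    have h1 : B - B' ≠ 0 := sub_ne_zero.2 hne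
    have h2 : 0 < (B - B') ⬝ᵥ (B - B') := by
      refine lt_of_le_of_ne (Finset.sum_nonneg fun i _ => mul_self_nonneg _) fun h => h1 ?_
      exact dotProduct_self_eq_zero.1 h.symm
    rw [hbb]; positivity
  have hc1 : Δ ^ 2 / 4 ≤ c ⬝ᵥ c := by rw [hcc]; linarith
  obtain ⟨η, hη, hbη⟩ : ∃ η : ℝ, 0 < η ∧ b ⬝ᵥ b = η ^ 2 :=
    ⟨√(b ⬝ᵥ b), Real.sqrt_pos.2 hb0, (Real.sq_sqrt hb0.le).symm⟩
  have hc0 : 0 < c ⬝ᵥ c := lt_of_lt_of_le (by positivity) hc1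
  obtain ⟨σ, hσ, hcσ⟩ : ∃ σ : ℝ, 0 < σ ∧ c ⬝ᵥ c = σ ^ 2 :=
    ⟨√(c ⬝ᵥ c), Real.sqrt_pos.2 hc0, (Real.sq_sqrt hc0.le).symm⟩
  have hηΔ : η ≤ Δ := by nlinarith
  have hσΔ : σ ≤ Δ := by nlinarith
  have hσ2 : Δ / 2 ≤ σ := by nlinarith
  have hmb := measurable_dotProduct_left b
  have hmc := measurable_dotProduct_left c
  let E₁ : Set ℝ := {x | η ≤ |x|}
  let E₂ : Set ℝ := {x | |x + ℓ| ≤ η / 2}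
  have hE₁ : MeasurableSet E₁ := measurableSet_le measurable_const measurable_id.abs
  have hE₂ : MeasurableSet E₂ :=
    measurableSet_le (measurable_id.add_const ℓ).abs measurable_const
  have hE : (gaussianPi (0 : Tensor d)).real
      ((fun z => b ⬝ᵥ z) ⁻¹' E₁ ∩ (fun z => c ⬝ᵥ z) ⁻¹' E₂) =
      (gaussianPi (0 : Tensor d)).real ((fun z => b ⬝ᵥ z) ⁻¹' E₁) *
        (gaussianPi (0 : Tensor d)).real ((fun z => c ⬝ᵥ z) ⁻¹' E₂) := by
    rw [Measure.real, (indepFun_dotProduct_gaussianPi 0 hbc).measure_inter_preimage_eq_mul _ _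
      hE₁ hE₂, ENNReal.toReal_mul]
    rfl
  have hp1 : (gaussianPi (0 : Tensor d)).real ((fun z => b ⬝ᵥ z) ⁻¹' E₁) = normalTail := by
    have hs : MeasurableSet {x : ℝ | 1 ≤ |x|} := measurableSet_le measurable_const measurable_id.abs
    rw [normalTail, ← map_standardize_gaussianPi (0 : Tensor d) b hη hbη, map_measureReal_apply
      ((hmb.sub_const _).const_mul _) hs]
    congr 1
    ext z
    simp only [E₁, Set.mem_preimage, Set.mem_ofPred_eq, dotProduct_zero, sub_zero, abs_mul, abs_inv,
      abs_of_pos hη]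
    rw [inv_mul_eq_div, le_div_iff₀ hη, one_mul]
  have hp2 : η / Δ * ((√(2 * Real.pi))⁻¹ * Real.exp (-(2 * |ℓ| / Δ + 1) ^ 2 / 2)) ≤
      (gaussianPi (0 : Tensor d)).real ((fun z => c ⬝ᵥ z) ⁻¹' E₂) := by
    have h1 : (gaussianPi (0 : Tensor d)).real ((fun z => c ⬝ᵥ z) ⁻¹' E₂) =
        (gaussianReal 0 1).real (Set.Icc ((-ℓ - η / 2) / σ) ((-ℓ + η / 2) / σ)) := by
      rw [← map_standardize_gaussianPi (0 : Tensor d) c hσ hcσ, map_measureReal_apply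
        ((hmc.sub_const _).const_mul _) measurableSet_Icc]
      congr 1
      ext z
      simp only [E₂, Set.mem_preimage, Set.mem_ofPred_eq, dotProduct_zero, sub_zero, Set.mem_Icc,
        inv_mul_eq_div, div_le_div_iff_of_pos_right hσ, abs_le]
      constructor <;> rintro ⟨h1, h2⟩ <;> constructor <;> linarith
    have hR : (|ℓ| + η / 2) / σ ≤ 2 * |ℓ| / Δ + 1 := by
      rw [div_le_iff₀ hσ]
      have h2 : (2 * |ℓ| / Δ + 1) * (Δ / 2) = |ℓ| + Δ / 2 := by field_simp
      have h3 : (2 * |ℓ| / Δ + 1) * (Δ / 2) ≤ (2 * |ℓ| / Δ + 1) * σ :=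
        mul_le_mul_of_nonneg_left hσ2 (by positivity)
      linarith
    rw [h1]
    refine le_trans ?_ (le_gaussianReal_Icc (R := 2 * |ℓ| / Δ + 1) ?_ ?_ ?_)
    · refine mul_le_mul_of_nonneg_right ?_ (by positivity)
      rw [← sub_div]
      have : -ℓ + η / 2 - (-ℓ - η / 2) = η := by ring
      rw [this]
      gcongr
    · gcongr; linarith
    · refine (neg_le_neg hR).trans ?_
      rw [← neg_div]
      gcongr
      linarith [le_abs_self ℓ]
    · refine le_trans ?_ hR
      gcongr
      exact neg_le_abs ℓ
  have hmain := le_excess_risk_add hw (a := 0) (a' := 0) hΔ hB hB' hr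
    ((hmb hE₁).inter (hmc hE₂)) zero_le_one (η := η) (by simp) (by simp) fun z hz => by
      refine ⟨c ⬝ᵥ z + ℓ, b ⬝ᵥ z, hz.2, hz.1, ?_, ?_⟩
      · simp only [logRatio, sub_zero, hb, hc, smul_dotProduct, add_dotProduct, sub_dotProduct,
          smul_eq_mul]
        ring
      · simp only [logRatio, sub_zero, hb, hc, smul_dotProduct, add_dotProduct, sub_dotProduct,
          smul_eq_mul]
        ring
  refine le_trans ?_ hmain
  rw [mul_assoc]
  refine mul_le_mul_of_nonneg_left ?_ (by positivity)
  rw [hE, hp1, one_mul, show (B - B') ⬝ᵥ (B - B') = 4 * η ^ 2 by rw [← hbη, hbb]; ring]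
  have hR0 : 0 ≤ 2 * |ℓ| / Δ + 1 := by positivity
  have hexp : Real.exp (-(Δ + Δ⁻¹ + (2 * |ℓ| / Δ + 1) + (2 * |ℓ| / Δ + 1) ^ 2 / 2)) ≤
      1 / Δ * Real.exp (-(2 * |ℓ| / Δ + 1) ^ 2 / 2) := by
    have h1 : Real.exp (-Δ) ≤ 1 / Δ := by
      rw [Real.exp_neg, ← one_div]
      exact one_div_le_one_div_of_le hΔ ((by linarith : Δ ≤ Δ + 1).trans (Real.add_one_le_exp Δ))
    refine le_trans ?_ (mul_le_mul_of_nonneg_right h1 (Real.exp_pos _).le)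
    rw [← Real.exp_add]
    refine Real.exp_le_exp.2 ?_
    have : 0 < Δ⁻¹ := by positivity
    have e : -(2 * |ℓ| / Δ + 1) ^ 2 / 2 = -((2 * |ℓ| / Δ + 1) ^ 2 / 2) := by ring
    rw [e]
    linarith
  have hnt := normalTail_pos
  calc sepFactor w Δ * (4 * η ^ 2)
      ≤ normalTail * (√(2 * Real.pi))⁻¹ / 8 *
        (1 / Δ * Real.exp (-(2 * |ℓ| / Δ + 1) ^ 2 / 2)) * (4 * η ^ 2) := by
        rw [sepFactor]; gcongr
    _ = η / 2 * (normalTail *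
        (η / Δ * ((√(2 * Real.pi))⁻¹ * Real.exp (-(2 * |ℓ| / Δ + 1) ^ 2 / 2)))) := by ring
    _ ≤ _ := by gcongr

/-- Separation of two midpoints on the discriminant axis. -/
theorem separation_shift {w : Fin 2 → ℝ} (hw : ∀ k, 0 < w k) {B : Tensor d} {Δ : ℝ}
    (hΔ : 0 < Δ) (hB : B ⬝ᵥ B = Δ ^ 2) {x x' : ℝ} (hx : |x| ≤ 1 / 2) (hx' : |x'| ≤ 1 / 2)
    {rule : Tensor d → Fin 2} (hr : Measurable rule) :
    √(w 0 * w 1) * Real.exp (-(Δ ^ 2 / 8)) * sepFactor w Δ * (x - x') ^ 2 ≤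
      ((isoParam ((x / Δ) • B) B).risk w rule - (isoParam ((x / Δ) • B) B).optRisk w) +
      ((isoParam ((x' / Δ) • B) B).risk w rule - (isoParam ((x' / Δ) • B) B).optRisk w) := by
  set ℓ := Real.log (w 1 / w 0) with hℓ
  set R := 2 * |ℓ| / Δ + 1 with hR
  set h := |x - x'| with hh
  have hh0 : 0 ≤ h := abs_nonneg _
  have hh1 : h ≤ 1 := by
    have := abs_sub x x'
    linarith
  set m := (x + x') / 2 - ℓ / Δ with hm
  have hmb : Measurable fun z : Tensor d => Δ⁻¹ * (B ⬝ᵥ z - B ⬝ᵥ (0 : Tensor d)) :=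
    ((measurable_dotProduct_left B).sub_const _).const_mul _
  let E : Set (Tensor d) := (fun z => Δ⁻¹ * (B ⬝ᵥ z - B ⬝ᵥ (0 : Tensor d))) ⁻¹'
    Set.Icc (m - h / 4) (m + h / 4)
  have hℓR : |ℓ| / Δ + 1 ≤ R := by
    have : 0 ≤ |ℓ| / Δ := by positivity
    rw [hR, mul_div_assoc]; linarith
  have hmR : |m| + h / 4 ≤ R := by
    refine le_trans ?_ hℓR
    have h1 : |m| ≤ |(x + x') / 2| + |ℓ / Δ| := abs_sub _ _
    have h2 : |(x + x') / 2| ≤ 1 / 2 := by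
      rw [abs_div, abs_two]
      have := abs_add_le x x'
      linarith
    rw [abs_div ℓ, abs_of_pos hΔ] at h1
    linarith
  have hEp : h / 2 * ((√(2 * Real.pi))⁻¹ * Real.exp (-R ^ 2 / 2)) ≤
      (gaussianPi (0 : Tensor d)).real E := by
    have h1 := le_gaussianReal_Icc (a := m - h / 4) (b := m + h / 4) (R := R) (by linarith)
      (by linarith [neg_abs_le m]) (by linarith [le_abs_self m])
    rw [← map_standardize_gaussianPi (0 : Tensor d) B hΔ hB, map_measureReal_apply hmb
      measurableSet_Icc] at h1
    refine le_trans (le_of_eq ?_) h1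
    ring
  have hEy : ∀ z ∈ E, |Δ⁻¹ * (B ⬝ᵥ z)| ≤ R ∧ |Δ⁻¹ * (B ⬝ᵥ z) - m| ≤ h / 4 := by
    intro z hz
    simp only [E, Set.mem_preimage, dotProduct_zero, sub_zero, Set.mem_Icc] at hz
    have h1 : |Δ⁻¹ * (B ⬝ᵥ z) - m| ≤ h / 4 := abs_le.2 ⟨by linarith [hz.1], by linarith [hz.2]⟩
    refine ⟨?_, h1⟩
    have := abs_sub_abs_le_abs_sub (Δ⁻¹ * (B ⬝ᵥ z)) m
    linarith
  have hK : ∀ x : ℝ, |x| ≤ 1 / 2 → ∀ z ∈ E, Real.exp (-R) ≤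
      Real.exp (((x / Δ) • B) ⬝ᵥ z - ((x / Δ) • B) ⬝ᵥ ((x / Δ) • B) / 2) := by
    intro x hx z hz
    refine Real.exp_le_exp.2 ?_
    simp only [smul_dotProduct, dotProduct_smul, smul_eq_mul, hB]
    have h1 : x / Δ * (B ⬝ᵥ z) - x / Δ * (x / Δ * Δ ^ 2) / 2 =
        x * (Δ⁻¹ * (B ⬝ᵥ z)) - x ^ 2 / 2 := by field_simp
    have h2 : |x * (Δ⁻¹ * (B ⬝ᵥ z))| ≤ 1 / 2 * R := by
      rw [abs_mul]
      exact mul_le_mul hx (hEy z hz).1 (abs_nonneg _) (by norm_num)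
    have h3 : x ^ 2 ≤ (1 / 2) ^ 2 := sq_le_sq.2 (by rwa [abs_of_pos (by norm_num : (0:ℝ) < 1 / 2)])
    have h4 : 1 ≤ R := by rw [hR]; linarith [show 0 ≤ 2 * |ℓ| / Δ by positivity]
    rw [h1]
    linarith [neg_abs_le (x * (Δ⁻¹ * (B ⬝ᵥ z)))]
  have hmain := le_excess_risk_add hw (a := (x / Δ) • B) (a' := (x' / Δ) • B) hΔ hB hB hr
    (hmb measurableSet_Icc : MeasurableSet E) (Real.exp_pos (-R)).le (η := Δ * h / 2)
    (hK x hx) (hK x' hx') fun z hz => by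
      refine ⟨Δ * (Δ⁻¹ * (B ⬝ᵥ z) - m), Δ * (x' - x) / 2, ?_, ?_, ?_, ?_⟩
      · rw [abs_mul, abs_of_pos hΔ]
        have := mul_le_mul_of_nonneg_left (hEy z hz).2 hΔ.le
        linarith
      · rw [abs_div, abs_mul, abs_of_pos hΔ, abs_two, abs_sub_comm]
      · simp only [logRatio, dotProduct_sub, dotProduct_smul, hB, smul_eq_mul, hm, ← hℓ]
        field_simp
        ring
      · simp only [logRatio, dotProduct_sub, dotProduct_smul, hB, smul_eq_mul, hm, ← hℓ]
        field_simp
        ring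
  refine le_trans ?_ hmain
  rw [mul_assoc]
  refine mul_le_mul_of_nonneg_left ?_ (by positivity)
  have hexp : Real.exp (-(Δ + Δ⁻¹ + R + R ^ 2 / 2)) ≤
      Δ * (Real.exp (-R) * Real.exp (-R ^ 2 / 2)) := by
    have h1 : Real.exp (-Δ⁻¹) ≤ Δ := by
      rw [Real.exp_neg]
      refine inv_le_of_inv_le₀ hΔ ?_
      exact (by linarith : Δ⁻¹ ≤ Δ⁻¹ + 1).trans (Real.add_one_le_exp _)
    refine le_trans ?_ (mul_le_mul_of_nonneg_right h1 (by positivity))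
    rw [← Real.exp_add, ← Real.exp_add]
    refine Real.exp_le_exp.2 ?_
    have e : -R ^ 2 / 2 = -(R ^ 2 / 2) := by ring
    rw [e]
    linarith
  have hnt : normalTail ≤ 1 := measureReal_le_one
  have hnt0 := normalTail_pos
  calc sepFactor w Δ * (x - x') ^ 2
      ≤ 1 * (√(2 * Real.pi))⁻¹ / 8 * (Δ * (Real.exp (-R) * Real.exp (-R ^ 2 / 2))) * h ^ 2 := by
        rw [sepFactor, hh, sq_abs]; gcongr
    _ = Real.exp (-R) * (Δ * h / 2 / 2 *
        (h / 2 * ((√(2 * Real.pi))⁻¹ * Real.exp (-R ^ 2 / 2)))) := by ring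
    _ ≤ _ := by gcongr

end Risk

/-! ### Tensors of bounded Tucker rank -/

/-- Thin QR factorization, without a rank assumption. -/
lemma exists_orthonormal_factorization {D R : ℕ} (hRD : R ≤ D) (V : Matrix (Fin D) (Fin R) ℝ) :
    ∃ (U : Matrix (Fin D) (Fin R) ℝ) (T : Matrix (Fin R) (Fin R) ℝ), Uᵀ * U = 1 ∧ V = U * T := by
  let f : Fin D → EuclideanSpace ℝ (Fin D) := fun i =>
    if h : i.val < R then WithLp.toLp 2 fun l => V l ⟨i, h⟩ else 0
  let b := InnerProductSpace.gramSchmidtOrthonormalBasis (𝕜 := ℝ) (E := EuclideanSpace ℝ (Fin D))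
    (ι := Fin D) (by simp) f
  refine ⟨Matrix.of fun l j => b (Fin.castLE hRD j) l,
    Matrix.of fun j i => Inner.inner ℝ (b (Fin.castLE hRD j)) (f (Fin.castLE hRD i)), ?_, ?_⟩
  · ext i j
    have h := orthonormal_iff_ite.1 b.orthonormal (Fin.castLE hRD i) (Fin.castLE hRD j)
    rw [PiLp.inner_apply] at h
    simp only [RCLike.inner_apply, conj_trivial, Fin.castLE_inj] at h
    rw [Matrix.mul_apply, Matrix.one_apply, ← h]
    exact Finset.sum_congr rfl fun l _ => by simp [mul_comm]
  · ext l i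
    have h1 := congrArg (fun x : EuclideanSpace ℝ (Fin D) => x l)
      (b.sum_repr' (f (Fin.castLE hRD i)))
    have h2 : f (Fin.castLE hRD i) l = V l i := by
      simp [f]
    -- the coefficients on the basis vectors beyond the first `R` vanish
    have h3 : ∀ j : Fin D, j ∉ Finset.univ.map (Fin.castLEEmb hRD) →
        Inner.inner ℝ (b j) (f (Fin.castLE hRD i)) * b j l = 0 := by
      intro j hj
      have hij : Fin.castLE hRD i < j := by
        by_contra hlt
        refine hj (Finset.mem_map.2 ⟨⟨j, ?_⟩, Finset.mem_univ _, Fin.ext rfl⟩)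
        have : j.val ≤ i.val := by
          simpa [Fin.lt_def] using hlt
        exact this.trans_lt i.2
      rw [InnerProductSpace.gramSchmidtOrthonormalBasis_inv_triangular _ f hij, zero_mul]
    simp only [WithLp.ofLp_sum, Finset.sum_apply, PiLp.smul_apply, smul_eq_mul] at h1
    rw [h2] at h1
    rw [← h1, Matrix.mul_apply, ← Finset.sum_subset (Finset.subset_univ
      (Finset.univ.map (Fin.castLEEmb hRD))) fun j _ hj => h3 j hj, Finset.sum_map]
    exact Finset.sum_congr rfl fun j _ => by simp [mul_comm]

section ModeProd

variable {M : ℕ} {d r : Fin M → ℕ}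

lemma modeProd_modeProd {d₁ d₂ d₃ : Fin M → ℕ} (X : Tensor d₁)
    (A : (m : Fin M) → Matrix (Fin (d₂ m)) (Fin (d₁ m)) ℝ)
    (B : (m : Fin M) → Matrix (Fin (d₃ m)) (Fin (d₂ m)) ℝ) :
    modeProd (modeProd X A) B = modeProd X fun m => B m * A m := by
  funext I
  simp only [modeProd, Matrix.mul_apply, Finset.prod_univ_sum, Fintype.piFinset_univ,
    Finset.sum_mul, Finset.mul_sum]
  rw [Finset.sum_comm]
  refine Finset.sum_congr rfl fun K _ => Finset.sum_congr rfl fun J _ => ?_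
  rw [Finset.prod_mul_distrib]
  ring

/-- The embedding of the leading `r 0 × r 1 × ⋯` block. -/
def blockEmb (h : ∀ m, r m ≤ d m) (I : Idx r) : Idx d := fun m => Fin.castLE (h m) (I m)

lemma blockEmb_injective (h : ∀ m, r m ≤ d m) : Function.Injective (blockEmb h) := by
  intro I J hIJ
  funext m
  exact Fin.castLE_injective (h m) (congrFun hIJ m)

/-- The coordinate embedding of the first `R` coordinates as a matrix. -/
def blockMatrix (D R : ℕ) : Matrix (Fin D) (Fin R) ℝ :=
  Matrix.of fun i j => if i.val = j.val then 1 else 0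

lemma blockMatrix_transpose_mul_self {D R : ℕ} (h : R ≤ D) :
    (blockMatrix D R)ᵀ * blockMatrix D R = 1 := by
  ext i j
  rw [Matrix.mul_apply, Finset.sum_eq_single (Fin.castLE h i), Matrix.one_apply]
  · simp [blockMatrix, Fin.ext_iff]
  · intro l _ hl
    have : l.val ≠ i.val := fun h' => hl (Fin.ext h')
    simp [blockMatrix, this]
  · simp

/-- `B` has Tucker rank at most `r`. -/
def HasTuckerForm (r : Fin M → ℕ) (B : Tensor d) : Prop :=
  ∃ (F : Tensor r) (U : (m : Fin M) → Matrix (Fin (d m)) (Fin (r m)) ℝ),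
    (∀ m, (U m)ᵀ * U m = 1) ∧ B = modeProd F U

lemma hasTuckerForm_of_support (h : ∀ m, r m ≤ d m) {B : Tensor d}
    (hB : ∀ I, I ∉ Set.range (blockEmb h) → B I = 0) : HasTuckerForm r B := by
  refine ⟨fun J => B (blockEmb h J), fun m => blockMatrix (d m) (r m),
    fun m => blockMatrix_transpose_mul_self (h m), ?_⟩
  funext I
  have hprod : ∀ J : Idx r, ∏ m, blockMatrix (d m) (r m) (I m) (J m) =
      if blockEmb h J = I then 1 else 0 := by
    intro J
    simp only [blockMatrix, Matrix.of_apply]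
    have : (∀ m ∈ Finset.univ, (I m).val = (J m).val) ↔ blockEmb h J = I := by
      simp [funext_iff, blockEmb, Fin.ext_iff, eq_comm]
    rw [Finset.prod_boole]
    by_cases hJ : blockEmb h J = I
    · rw [if_pos (this.2 hJ), if_pos hJ]
    · rw [if_neg (mt this.1 hJ), if_neg hJ]
  rw [modeProd]
  simp_rw [hprod]
  by_cases hI : I ∈ Set.range (blockEmb h)
  · obtain ⟨J, rfl⟩ := hI
    simp [(blockEmb_injective h).eq_iff]
  · rw [hB I hI, Finset.sum_eq_zero]
    intro J _
    rw [if_neg fun h' => hI ⟨J, h'⟩, mul_zero]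

/-- A sum of `r m` mode-`m` fibres, through the points `κ i`, filled with the columns of an
arbitrary matrix `V`. The columns of `V` need not be orthonormal: the triangular factor of `V` is absorbed
into the core. -/
lemma hasTuckerForm_of_fibres (h : ∀ m, r m ≤ d m) (m : Fin M) (κ : Fin (r m) → Idx r)
    (hκ : ∀ i, κ i m = i) (V : Matrix (Fin (d m)) (Fin (r m)) ℝ) :
    HasTuckerForm r (fun I : Idx d => ∑ i, ∑ l,
      if Function.update (blockEmb h (κ i)) m l = I then V l i else 0) := by
  obtain ⟨U, T, hU, hV⟩ := exists_orthonormal_factorization (h m) V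
  let E : (j : Fin M) → Matrix (Fin (d j)) (Fin (r j)) ℝ := fun j => blockMatrix (d j) (r j)
  let F : Tensor r := fun J => ∑ i, if κ i = J then 1 else 0
  refine ⟨modeProd F (Function.update (fun _ => 1) m T), Function.update E m U, fun j => ?_, ?_⟩
  · by_cases hj : j = m
    · subst hj; simpa using hU
    · simp only [Function.update_of_ne hj]
      exact blockMatrix_transpose_mul_self (h j)
  · have hmul : (fun j => Function.update E m U j *
        (Function.update (fun _ => 1) m T : (j : Fin M) → Matrix (Fin (r j)) (Fin (r j)) ℝ) j) =
        Function.update E m V := by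
      funext j
      by_cases hj : j = m
      · subst hj; simp [hV]
      · simp [Function.update_of_ne hj]
    rw [modeProd_modeProd, hmul]
    funext I
    simp only [modeProd, F, Finset.sum_mul]
    conv_rhs => rw [Finset.sum_comm]
    refine Finset.sum_congr rfl fun i _ => ?_
    simp only [ite_mul, one_mul, zero_mul, Finset.sum_ite_eq, Finset.mem_univ, if_true]
    rw [← Finset.mul_prod_erase _ _ (Finset.mem_univ m)]
    have h1 : ∀ j ∈ Finset.univ.erase m, Function.update E m V j (I j) (κ i j) =
        if (I j).val = (κ i j).val then 1 else 0 := by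
      intro j hj
      rw [Function.update_of_ne (Finset.ne_of_mem_erase hj)]
      rfl
    rw [Finset.prod_congr rfl h1, Function.update_self, hκ]
    by_cases hP : ∀ j ∈ Finset.univ.erase m, (I j).val = (κ i j).val
    · rw [Finset.prod_eq_one fun j hj => if_pos (hP j hj), mul_one, Finset.sum_eq_single (I m)]
      · rw [if_pos]
        refine Function.update_eq_iff.2 ⟨rfl, fun j hj => ?_⟩
        exact Fin.ext (hP j (Finset.mem_erase.2 ⟨hj, Finset.mem_univ j⟩)).symm
      · intro l _ hl
        rw [if_neg]
        intro h'
        exact hl (by rw [← h', Function.update_self])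
      · simp
    · have hP' := hP
      push Not at hP'
      obtain ⟨j₀, hj₀, hne⟩ := hP'
      rw [Finset.prod_eq_zero hj₀ (if_neg hne), mul_zero]
      refine Finset.sum_eq_zero fun l _ => if_neg fun h' => hP fun j hj => ?_
      rw [← h', Function.update_of_ne (Finset.ne_of_mem_erase hj)]
      rfl

end ModeProd

/-! ### Grids of discriminant tensors on a sphere -/

section Sphere

variable {M : ℕ} {d : Fin M → ℕ} {J : Type*} [Fintype J]

/-- The tensor with entries `x j` at the positions `pos j` and zeros elsewhere. -/
def placeAt (pos : J → Idx d) (x : J → ℝ) : Tensor d := fun I => ∑ j, if pos j = I then x j else 0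

/-- The point of the sphere of radius `Δ` with coordinates `x` at the positions `pos`, completed
along the unit tensor `u`. -/
def spherePoint (u : Tensor d) (pos : J → Idx d) (Δ : ℝ) (x : J → ℝ) : Tensor d :=
  √(Δ ^ 2 - ∑ j, x j ^ 2) • u + placeAt pos x

lemma placeAt_dotProduct (pos : J → Idx d) (x : J → ℝ) (f : Tensor d) :
    placeAt pos x ⬝ᵥ f = ∑ j, x j * f (pos j) := by
  simp only [placeAt, dotProduct, Finset.sum_mul]
  rw [Finset.sum_comm]
  refine Finset.sum_congr rfl fun j _ => ?_
  simp [ite_mul]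

lemma placeAt_apply {pos : J → Idx d} (hpos : Function.Injective pos) (x : J → ℝ) (j : J) :
    placeAt pos x (pos j) = x j := by
  classical
  simp [placeAt, hpos.eq_iff]

lemma placeAt_sub (pos : J → Idx d) (x y : J → ℝ) :
    placeAt pos x - placeAt pos y = placeAt pos (x - y) := by
  funext I
  simp only [placeAt, Pi.sub_apply, ← Finset.sum_sub_distrib]
  refine Finset.sum_congr rfl fun j _ => ?_
  split_ifs <;> simp

lemma placeAt_add (pos : J → Idx d) (x y : J → ℝ) :
    placeAt pos x + placeAt pos y = placeAt pos (x + y) := by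
  funext I
  simp only [placeAt, Pi.add_apply, ← Finset.sum_add_distrib]
  refine Finset.sum_congr rfl fun j _ => ?_
  split_ifs <;> simp

lemma smul_add_placeAt_dotProduct_self {u : Tensor d} {pos : J → Idx d}
    (hpos : Function.Injective pos) (hu : u ⬝ᵥ u = 1) (hup : ∀ j, u (pos j) = 0) (c : ℝ)
    (x : J → ℝ) :
    (c • u + placeAt pos x) ⬝ᵥ (c • u + placeAt pos x) = c ^ 2 + ∑ j, x j ^ 2 := by
  have h1 : placeAt pos x ⬝ᵥ u = 0 := by simp [placeAt_dotProduct, hup]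
  have h2 : placeAt pos x ⬝ᵥ placeAt pos x = ∑ j, x j ^ 2 := by
    simp [placeAt_dotProduct, placeAt_apply hpos, sq]
  simp only [add_dotProduct, dotProduct_add, smul_dotProduct, dotProduct_smul, smul_eq_mul, hu,
    h1, dotProduct_comm u, h2]
  ring

variable {u : Tensor d} {pos : J → Idx d} {Δ : ℝ}

lemma spherePoint_dotProduct_self (hpos : Function.Injective pos) (hu : u ⬝ᵥ u = 1)
    (hup : ∀ j, u (pos j) = 0) {x : J → ℝ} (hx : ∑ j, x j ^ 2 ≤ Δ ^ 2) :
    spherePoint u pos Δ x ⬝ᵥ spherePoint u pos Δ x = Δ ^ 2 := by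
  rw [spherePoint, smul_add_placeAt_dotProduct_self hpos hu hup, Real.sq_sqrt (by linarith)]
  ring

lemma spherePoint_sub_dotProduct_self (hpos : Function.Injective pos) (hu : u ⬝ᵥ u = 1)
    (hup : ∀ j, u (pos j) = 0) (x y : J → ℝ) :
    (spherePoint u pos Δ x - spherePoint u pos Δ y) ⬝ᵥ
      (spherePoint u pos Δ x - spherePoint u pos Δ y) =
      (√(Δ ^ 2 - ∑ j, x j ^ 2) - √(Δ ^ 2 - ∑ j, y j ^ 2)) ^ 2 + ∑ j, (x j - y j) ^ 2 := by
  have h : spherePoint u pos Δ x - spherePoint u pos Δ y =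
      (√(Δ ^ 2 - ∑ j, x j ^ 2) - √(Δ ^ 2 - ∑ j, y j ^ 2)) • u + placeAt pos (x - y) := by
    rw [spherePoint, spherePoint, ← placeAt_sub, sub_smul]
    abel
  rw [h, smul_add_placeAt_dotProduct_self hpos hu hup]
  simp

lemma half_le_sqrt_sub {t : ℝ} (ht : t ≤ 3 / 4 * Δ ^ 2) : Δ / 2 ≤ √(Δ ^ 2 - t) :=
  Real.le_sqrt_of_sq_le (by nlinarith)

lemma le_spherePoint_add_dotProduct_self (hΔ : 0 < Δ) (hpos : Function.Injective pos)
    (hu : u ⬝ᵥ u = 1) (hup : ∀ j, u (pos j) = 0) {x y : J → ℝ}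
    (hx : ∑ j, x j ^ 2 ≤ 3 / 4 * Δ ^ 2) (hy : ∑ j, y j ^ 2 ≤ 3 / 4 * Δ ^ 2) :
    Δ ^ 2 ≤ (spherePoint u pos Δ x + spherePoint u pos Δ y) ⬝ᵥ
      (spherePoint u pos Δ x + spherePoint u pos Δ y) := by
  have h : spherePoint u pos Δ x + spherePoint u pos Δ y =
      (√(Δ ^ 2 - ∑ j, x j ^ 2) + √(Δ ^ 2 - ∑ j, y j ^ 2)) • u + placeAt pos (x + y) := by
    rw [spherePoint, spherePoint, ← placeAt_add, add_smul]
    abel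
  rw [h, smul_add_placeAt_dotProduct_self hpos hu hup]
  have h1 := half_le_sqrt_sub hx
  have h2 := half_le_sqrt_sub hy
  have h3 : 0 ≤ ∑ j, (x + y) j ^ 2 := Finset.sum_nonneg fun j _ => sq_nonneg _
  nlinarith

/-- Moving a single coordinate moves the point of the sphere by a comparable distance. -/
lemma spherePoint_update_le [DecidableEq J] (hΔ : 0 < Δ) (hpos : Function.Injective pos)
    (hu : u ⬝ᵥ u = 1) (hup : ∀ j, u (pos j) = 0) {x : J → ℝ} {j : J} {y : ℝ}
    (hx : ∑ j, x j ^ 2 ≤ 3 / 4 * Δ ^ 2)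
    (hy : ∑ i, Function.update x j y i ^ 2 ≤ 3 / 4 * Δ ^ 2) :
    (spherePoint u pos Δ (Function.update x j y) - spherePoint u pos Δ x) ⬝ᵥ
      (spherePoint u pos Δ (Function.update x j y) - spherePoint u pos Δ x) ≤
        5 * (y - x j) ^ 2 := by
  rw [spherePoint_sub_dotProduct_self hpos hu hup]
  have hsum : ∑ i, (Function.update x j y i - x i) ^ 2 = (y - x j) ^ 2 := by
    rw [Finset.sum_eq_single j]
    · simp
    · intro i _ hi; simp [hi]
    · simp
  have hdiff : ∑ i, Function.update x j y i ^ 2 - ∑ i, x i ^ 2 = y ^ 2 - x j ^ 2 := by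
    rw [← Finset.sum_sub_distrib, Finset.sum_eq_single j]
    · simp
    · intro i _ hi; simp [hi]
    · simp
  have hxj : x j ^ 2 ≤ Δ ^ 2 := by
    have := Finset.single_le_sum (f := fun i => x i ^ 2) (fun i _ => sq_nonneg _)
      (Finset.mem_univ j)
    nlinarith
  have hyj : y ^ 2 ≤ Δ ^ 2 := by
    have := Finset.single_le_sum (f := fun i => Function.update x j y i ^ 2)
      (fun i _ => sq_nonneg _) (Finset.mem_univ j)
    simp only [Function.update_self] at this
    nlinarith
  have h1 := half_le_sqrt_sub hx
  have h2 := half_le_sqrt_sub hy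
  have e1 := Real.sq_sqrt (show 0 ≤ Δ ^ 2 - ∑ i, x i ^ 2 by nlinarith)
  have e2 := Real.sq_sqrt (show 0 ≤ Δ ^ 2 - ∑ i, Function.update x j y i ^ 2 by nlinarith)
  set p := √(Δ ^ 2 - ∑ i, x i ^ 2)
  set p' := √(Δ ^ 2 - ∑ i, Function.update x j y i ^ 2)
  rw [hsum]
  have hprod : (p' - p) * (p' + p) = -((y - x j) * (y + x j)) := by nlinarith
  have hb : (y + x j) ^ 2 ≤ 4 * Δ ^ 2 := by nlinarith [sq_nonneg (y - x j)]
  have hΔp : Δ ^ 2 ≤ (p' + p) ^ 2 := by nlinarith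
  have h5 : (p' - p) ^ 2 * Δ ^ 2 ≤ (4 * (y - x j) ^ 2) * Δ ^ 2 := by
    calc (p' - p) ^ 2 * Δ ^ 2 ≤ (p' - p) ^ 2 * (p' + p) ^ 2 := by gcongr
      _ = (y - x j) ^ 2 * (y + x j) ^ 2 := by rw [← mul_pow, hprod]; ring
      _ ≤ (y - x j) ^ 2 * (4 * Δ ^ 2) := by gcongr
      _ = _ := by ring
  have h6 := le_of_mul_le_mul_right h5 (by positivity)
  linarith

end Sphere

lemma sum_mean_sub_sq {M : ℕ} {d : Fin M → ℕ} (a a' B B' : Tensor d) :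
    ∑ k, ∑ I, ((isoParam a B).mean k I - (isoParam a' B').mean k I) ^ 2 =
      2 * ((a - a') ⬝ᵥ (a - a')) + 1 / 2 * ((B - B') ⬝ᵥ (B - B')) := by
  rw [Fin.sum_univ_two]
  simp only [isoParam, dotProduct, Finset.mul_sum, ← Finset.sum_add_distrib]
  refine Finset.sum_congr rfl fun I _ => ?_
  simp
  ring

section Grid

variable {M : ℕ} {d r : Fin M → ℕ} {n : Fin 2 → ℕ} {n₀ : ℕ} {C₀ κ₁ κ₂ κ₃ K : ℝ}
  {w : Fin 2 → ℝ} {Δ t α c δ τ : ℝ} {q : ℕ}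

lemma sum_grid_sq_le {J : Type*} [Fintype J] (hΔ : 0 ≤ Δ) (hn₀ : 1 ≤ n₀) (hτ : 0 ≤ τ)
    (hKτ : q ^ 2 * τ * K ≤ 3 / 4 * Δ) (hN : (Fintype.card J : ℝ) ≤ n₀ * (K * Δ)) (v : J → Fin q) :
    ∑ j, (√(τ / n₀) * (v j : ℕ)) ^ 2 ≤ 3 / 4 * Δ ^ 2 := by
  have hn : (0 : ℝ) < n₀ := by exact_mod_cast hn₀
  have h1 : ∀ j, (√(τ / n₀) * ((v j : ℕ) : ℝ)) ^ 2 ≤ τ / n₀ * q ^ 2 := by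
    intro j
    rw [mul_pow, Real.sq_sqrt (by positivity)]
    have : ((v j : ℕ) : ℝ) ≤ q := by exact_mod_cast (v j).2.le
    gcongr
  calc _ ≤ ∑ _ : J, τ / n₀ * q ^ 2 := Finset.sum_le_sum fun j _ => h1 j
    _ = Fintype.card J * (τ / n₀ * q ^ 2) := by simp
    _ ≤ (n₀ * (K * Δ)) * (τ / n₀ * q ^ 2) := by gcongr
    _ = (q ^ 2 * τ * K) * Δ := by field_simp
    _ ≤ (3 / 4 * Δ) * Δ := by gcongr
    _ = _ := by ring

lemma grid_sub_sq_le (hτ : 0 ≤ τ) (a b : Fin q) :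
    (√(τ / n₀) * (a : ℕ) - √(τ / n₀) * (b : ℕ)) ^ 2 ≤ τ / n₀ * q ^ 2 := by
  rw [← mul_sub, mul_pow, Real.sq_sqrt (by positivity)]
  have h1 : ((a : ℕ) : ℝ) ≤ q := by exact_mod_cast a.2.le
  have h2 : ((b : ℕ) : ℝ) ≤ q := by exact_mod_cast b.2.le
  have h3 : (0 : ℝ) ≤ (a : ℕ) := Nat.cast_nonneg _
  have h4 : (0 : ℝ) ≤ (b : ℕ) := Nat.cast_nonneg _
  have : (((a : ℕ) : ℝ) - (b : ℕ)) ^ 2 ≤ (q : ℝ) ^ 2 := sq_le_sq' (by linarith) (by linarith)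
  gcongr

lemma le_grid_sub_sq (hτ : 0 ≤ τ) {a b : Fin q} (hab : a ≠ b) :
    τ / n₀ ≤ (√(τ / n₀) * (a : ℕ) - √(τ / n₀) * (b : ℕ)) ^ 2 := by
  rw [← mul_sub, mul_pow, Real.sq_sqrt (by positivity)]
  have h1 : (1 : ℝ) ≤ (((a : ℕ) : ℝ) - (b : ℕ)) ^ 2 := by
    have h2 : ((a : ℕ) : ℤ) - (b : ℕ) ≠ 0 := by
      intro h
      exact hab (Fin.ext (by omega))
    have h3 : (1 : ℤ) ≤ (((a : ℕ) : ℤ) - (b : ℕ)) ^ 2 := by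
      have := sq_pos_of_ne_zero h2
      omega
    exact_mod_cast h3
  have : 0 ≤ τ / n₀ := by positivity
  nlinarith

lemma mul_hammingDist_le {J : Type*} [Fintype J] (hτ : 0 ≤ τ) (v v' : J → Fin q) :
    τ / n₀ * hammingDist v v' ≤
      ∑ j, (√(τ / n₀) * (v j : ℕ) - √(τ / n₀) * (v' j : ℕ)) ^ 2 := by
  rw [hammingDist, Finset.card_filter]
  push_cast
  rw [Finset.mul_sum]
  refine Finset.sum_le_sum fun j _ => ?_
  split_ifs with h
  · rw [mul_one]; exact le_grid_sub_sq hτ h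
  · rw [mul_zero]; exact sq_nonneg _

/-- The lower bound from a grid of directions: the number of free positions replaces the number of
degrees of freedom. -/
theorem le_minimaxProb_of_directions (hM : 1 ≤ M) (hd : ∀ m, 1 ≤ d m) (hn₀ : 1 ≤ n₀)
    (hn : ∀ k, n₀ ≤ n k) (hC₀ : 1 ≤ C₀) (hκ₁ : κ₁ ≤ 1) (hκ₂ : 2 ≤ κ₂) (hw : ∀ k, 0 < w k)
    (hΔ : 0 < Δ) [NeZero q] (hδ : 0 < δ)
    (hα : 2 * (1 / q + (δ / 2 + (Real.exp c - 1) / (2 * δ))) ≤ α)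
    (hτ : 0 < τ) (hcτ : 5 / 2 * (q ^ 2 * τ) ≤ c) (hKτ : q ^ 2 * τ * K ≤ 3 / 4 * Δ)
    {J : Type*} [Fintype J] [Nonempty J] (hN : (Fintype.card J : ℝ) ≤ n₀ * (K * Δ))
    {u : Tensor d} {pos : J → Idx d} (hpos : Function.Injective pos) (hu : u ⬝ᵥ u = 1)
    (hup : ∀ j, u (pos j) = 0) (htucker : ∀ (b : ℝ) x, HasTuckerForm r (b • u + placeAt pos x))
    (ht : 4 * t ≤ √(w 0 * w 1) * Real.exp (-(Δ ^ 2 / 8)) * sepFactor w Δ * (τ / n₀) *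
      Fintype.card J) :
    ENNReal.ofReal (1 - α) ≤ minimaxProb d r n n₀ C₀ κ₁ κ₂ κ₃ w Δ t := by
  classical
  have hn' : (0 : ℝ) < n₀ := by exact_mod_cast hn₀
  have hs := sepFactor_pos w Δ
  have hw0 := hw 0
  have hw1 := hw 1
  let x : (J → Fin q) → J → ℝ := fun v j => √(τ / n₀) * (v j : ℕ)
  have hx : ∀ v, ∑ j, x v j ^ 2 ≤ 3 / 4 * Δ ^ 2 := sum_grid_sq_le hΔ.le hn₀ hτ.le hKτ hN
  have hB : ∀ v, spherePoint u pos Δ (x v) ⬝ᵥ spherePoint u pos Δ (x v) = Δ ^ 2 := fun v =>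
    spherePoint_dotProduct_self hpos hu hup ((hx v).trans (by nlinarith [sq_nonneg Δ]))
  have hxu : ∀ v j a, x (Function.update v j a) =
      Function.update (x v) j (√(τ / n₀) * (a : ℕ)) := by
    intro v j a
    funext i
    by_cases hi : i = j
    · subst hi; simp [x]
    · simp [x, hi]
  refine le_minimaxProb hM hd hn hκ₁ hκ₂ (fun _ => 0) (fun v => spherePoint u pos Δ (x v))
    (fun v => ⟨isoParam_mem_paramSpace hC₀ (htucker _ _), ?_⟩) hδ ?_ hα
    (ρ := √(w 0 * w 1) * Real.exp (-(Δ ^ 2 / 8)) * sepFactor w Δ * (τ / n₀)) (by positivity) ht ?_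
  · rw [isoParam_snr, hB, Real.sqrt_sq hΔ.le]
  · intro v j a
    have h1 := hx (Function.update v j a)
    rw [hxu] at h1
    have h2 := spherePoint_update_le hΔ hpos hu hup (hx v) h1
    have h3 := grid_sub_sq_le (n₀ := n₀) hτ.le a (v j)
    rw [sum_mean_sub_sq, hxu]
    simp only [sub_self, zero_dotProduct, mul_zero, zero_add]
    calc _ ≤ (n₀ : ℝ) * (1 / 2 * (5 * (τ / n₀ * q ^ 2))) := by
          gcongr
          exact h2.trans (by gcongr)
      _ = 5 / 2 * (q ^ 2 * τ) := by field_simp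
      _ ≤ c := hcτ
  · intro v v' rule hvv hr
    have hdist := spherePoint_sub_dotProduct_self (Δ := Δ) hpos hu hup (x v) (x v')
    have hham := mul_hammingDist_le (n₀ := n₀) hτ.le v v'
    have hle : τ / n₀ * hammingDist v v' ≤
        (spherePoint u pos Δ (x v) - spherePoint u pos Δ (x v')) ⬝ᵥ
        (spherePoint u pos Δ (x v) - spherePoint u pos Δ (x v')) := by
      rw [hdist]
      exact hham.trans (le_add_of_nonneg_left (sq_nonneg _))
    have hne : spherePoint u pos Δ (x v) ≠ spherePoint u pos Δ (x v') := by
      intro h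
      rw [h, sub_self, zero_dotProduct] at hle
      have : 0 < τ / n₀ * (hammingDist v v' : ℝ) := by
        have := hammingDist_pos.2 hvv
        positivity
      linarith
    refine le_trans ?_ (separation_direction hw hΔ (hB v) (hB v') hne
      (le_spherePoint_add_dotProduct_self hΔ hpos hu hup (hx v) (hx v')) hr)
    rw [mul_assoc]
    gcongr

/-- The lower bound from the unknown midpoint of the two means, without any dimension factor. -/
theorem le_minimaxProb_of_shift (hM : 1 ≤ M) (hd : ∀ m, 1 ≤ d m) (hn₀ : 1 ≤ n₀)
    (hn : ∀ k, n₀ ≤ n k) (hC₀ : 1 ≤ C₀) (hκ₁ : κ₁ ≤ 1) (hκ₂ : 2 ≤ κ₂) (hw : ∀ k, 0 < w k)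
    (hΔ : 0 < Δ) [NeZero q] (hδ : 0 < δ)
    (hα : 2 * (1 / q + (δ / 2 + (Real.exp c - 1) / (2 * δ))) ≤ α)
    (hτ : 0 < τ) (hcτ : 5 / 2 * (q ^ 2 * τ) ≤ c) (hτ' : q ^ 2 * τ ≤ 1 / 4)
    {B : Tensor d} (hB : B ⬝ᵥ B = Δ ^ 2) (htucker : HasTuckerForm r B)
    (ht : 4 * t ≤ √(w 0 * w 1) * Real.exp (-(Δ ^ 2 / 8)) * sepFactor w Δ * (τ / n₀)) :
    ENNReal.ofReal (1 - α) ≤ minimaxProb d r n n₀ C₀ κ₁ κ₂ κ₃ w Δ t := by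
  have hn' : (1 : ℝ) ≤ n₀ := by exact_mod_cast hn₀
  have hs := sepFactor_pos w Δ
  have hw0 := hw 0
  have hw1 := hw 1
  let x : Fin q → ℝ := fun a => √(τ / n₀) * (a : ℕ)
  have hx : ∀ a, |x a| ≤ 1 / 2 := by
    intro a
    refine abs_le_of_sq_le_sq ?_ (by norm_num)
    simp only [x]
    rw [mul_pow, Real.sq_sqrt (by positivity)]
    have h1 : ((a : ℕ) : ℝ) ≤ q := by exact_mod_cast a.2.le
    calc τ / n₀ * ((a : ℕ) : ℝ) ^ 2 ≤ τ / 1 * q ^ 2 := by gcongr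
      _ ≤ _ := by rw [div_one, mul_comm]; linarith
  refine le_minimaxProb (J := Unit) hM hd hn hκ₁ hκ₂ (fun v => (x (v ()) / Δ) • B) (fun _ => B)
    (fun v => ⟨isoParam_mem_paramSpace hC₀ htucker, ?_⟩) hδ ?_ hα
    (ρ := √(w 0 * w 1) * Real.exp (-(Δ ^ 2 / 8)) * sepFactor w Δ * (τ / n₀)) (by positivity)
    (by simpa using ht) ?_
  · rw [isoParam_snr, hB, Real.sqrt_sq hΔ.le]
  · intro v j a
    have h3 := grid_sub_sq_le (n₀ := n₀) hτ.le a (v ())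
    rw [sum_mean_sub_sq, ← sub_smul]
    simp only [sub_self, zero_dotProduct, mul_zero, add_zero, smul_dotProduct, dotProduct_smul, hB,
      smul_eq_mul, Function.update_self]
    calc _ = (n₀ : ℝ) * (2 * (x a - x (v ())) ^ 2) := by field_simp
      _ ≤ (n₀ : ℝ) * (2 * (τ / n₀ * q ^ 2)) := by gcongr
      _ = 2 * (q ^ 2 * τ) := by field_simp
      _ ≤ c := by linarith [show 0 ≤ q ^ 2 * τ by positivity]
  · intro v v' rule hvv hr
    refine le_trans ?_ (separation_shift hw hΔ hB (hx (v ())) (hx (v' ())) hr)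
    have hham := mul_hammingDist_le (n₀ := n₀) hτ.le v v'
    simp only [Finset.univ_unique, Finset.sum_singleton] at hham
    rw [mul_assoc]
    gcongr

end Grid

/-! ### Free positions in number comparable to the degrees of freedom -/

section Positions

variable {M : ℕ} {d r : Fin M → ℕ}

/-- The entries at `pos` can be chosen freely, together with a multiple of `u`, among the tensors of
Tucker rank at most `r`. -/
structure IsFreeFamily (r : Fin M → ℕ) {J : Type} [Fintype J] (u : Tensor d)
    (pos : J → Idx d) : Prop where
  injective : Function.Injective pos
  unit : u ⬝ᵥ u = 1
  vanish : ∀ j, u (pos j) = 0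
  tucker : ∀ (b : ℝ) (x : J → ℝ), HasTuckerForm r (b • u + placeAt pos x)

/-- Free positions in the core: all entries of the leading block but one. -/
lemma isFreeFamily_block (h : ∀ m, r m ≤ d m) (I₀ : Idx r) :
    IsFreeFamily (d := d) r (Pi.single (blockEmb h I₀) 1)
      (fun I : {I : Idx r // I ≠ I₀} => blockEmb h I) where
  injective := (blockEmb_injective h).comp Subtype.val_injective
  unit := by simp
  vanish := fun I => Pi.single_eq_of_ne (fun h' => I.2 (blockEmb_injective h h')) 1
  tucker := fun b x => by
    refine hasTuckerForm_of_support h fun I hI => ?_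
    have h1 : ∀ J : Idx r, blockEmb h J ≠ I := fun J hJ => hI ⟨J, hJ⟩
    simp [placeAt, h1]

/-- Points of the leading block with `m`-th coordinate `i` whose other coordinates are pairwise
distinct as `i` varies: there is room for them because `r m ≤ ∏ j ≠ m, r j`. -/
lemma exists_fibre_points (hr : IsTuckerRank d r) (m : Fin M) :
    ∃ κ : Fin (r m) → Idx r, (∀ i, κ i m = i) ∧
      ∀ i i', (∀ j, j ≠ m → κ i j = κ i' j) → i = i' := by
  have hcard : Fintype.card (Fin (r m)) ≤ Fintype.card ((j : {j // j ≠ m}) → Fin (r j)) := by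
    rw [Fintype.card_pi, Fintype.card_fin]
    simp only [Fintype.card_fin]
    refine (hr m).2.2.trans (le_of_eq ?_)
    exact Finset.prod_subtype (Finset.univ.erase m) (by simp) r
  obtain ⟨e⟩ := Function.Embedding.nonempty_of_card_le hcard
  refine ⟨fun i j => if h : j = m then h ▸ i else e i ⟨j, h⟩, fun i => by simp, fun i i' h => ?_⟩
  refine e.injective (funext fun j => ?_)
  have := h j.1 j.2
  simpa [j.2] using this

/-- Free positions in the mode-`m` loading matrix: the rows beyond the first `r m`. The unit tensor
spreads its mass evenly over the first `r m` rows, which keeps the loading matrix of full rank. -/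
lemma exists_isFreeFamily_mode (hr : IsTuckerRank d r) (m : Fin M) :
    ∃ (u : Tensor d) (pos : Fin (d m - r m) × Fin (r m) → Idx d), IsFreeFamily r u pos := by
  have h : ∀ m, r m ≤ d m := fun m => (hr m).2.1
  obtain ⟨κ, hκ, hκ'⟩ := exists_fibre_points hr m
  have hrm : (0 : ℝ) < r m := by exact_mod_cast (hr m).1
  -- `P l i` is the `l`-th point of the `i`-th fibre
  let P : Fin (d m) → Fin (r m) → Idx d := fun l i => Function.update (blockEmb h (κ i)) m l
  have hP : ∀ l i l' i', P l i = P l' i' → l = l' ∧ i = i' := by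
    intro l i l' i' he
    refine ⟨by simpa [P] using congrFun he m, hκ' i i' fun j hj => ?_⟩
    have := congrFun he j
    simp only [P, Function.update_of_ne hj] at this
    exact Fin.castLE_injective (h j) this
  let low : Fin (d m - r m) → Fin (d m) := fun l => ⟨r m + l, by omega⟩
  have hlow : Function.Injective low := fun l l' hl => by
    simp only [low, Fin.mk.injEq] at hl
    exact Fin.ext (by omega)
  let top : Fin (r m) → Idx d := fun i => P (Fin.castLE (h m) i) i
  have htop : Function.Injective top := fun i i' hi => (hP _ _ _ _ hi).2
  let pos : Fin (d m - r m) × Fin (r m) → Idx d := fun p => P (low p.1) p.2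
  have hpt : ∀ i p, top i ≠ pos p := by
    intro i p he
    have := congrArg Fin.val (hP _ _ _ _ he).1
    simp only [Fin.val_castLE, low] at this
    omega
  refine ⟨placeAt top fun _ => (√(r m))⁻¹, pos, ⟨?_, ?_, ?_, ?_⟩⟩
  · intro p p' hpp
    obtain ⟨h1, h2⟩ := hP _ _ _ _ hpp
    exact Prod.ext (hlow h1) h2
  · rw [placeAt_dotProduct]
    simp only [placeAt_apply htop]
    rw [← mul_inv, Real.mul_self_sqrt hrm.le]
    simp [hrm.ne']
  · intro p
    simp [placeAt, hpt]
  · intro b x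
    let V : Matrix (Fin (d m)) (Fin (r m)) ℝ := Matrix.of fun l i =>
      (if Fin.castLE (h m) i = l then b * (√(r m))⁻¹ else 0) +
        ∑ l', if low l' = l then x (l', i) else 0
    have hV := hasTuckerForm_of_fibres h m κ hκ V
    convert hV using 1
    funext I
    have h1 : ∀ i, ∑ l, (if P l i = I then V l i else 0) =
        (if top i = I then b * (√(r m))⁻¹ else 0) +
          ∑ l', if pos (l', i) = I then x (l', i) else 0 := by
      intro i
      have : ∀ l, (if P l i = I then V l i else 0) =
          (if Fin.castLE (h m) i = l then (if P l i = I then b * (√(r m))⁻¹ else 0) else 0) +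
            ∑ l', if low l' = l then (if P l i = I then x (l', i) else 0) else 0 := by
        intro l
        by_cases hl : P l i = I <;> simp [hl, V]
      simp_rw [this]
      rw [Finset.sum_add_distrib, Finset.sum_comm]
      simp [top, pos]
    change _ = ∑ i, ∑ l, if P l i = I then V l i else 0
    simp_rw [h1]
    rw [Finset.sum_add_distrib]
    simp only [Pi.add_apply, Pi.smul_apply, placeAt, smul_eq_mul, Finset.mul_sum, mul_ite, mul_zero]
    congr 1
    rw [Fintype.sum_prod_type, Finset.sum_comm]

lemma dof_pos (hr : IsTuckerRank d r) : 0 < dof d r := by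
  have h1 : 0 < ∏ m, (r m : ℝ) := Finset.prod_pos fun m _ => by exact_mod_cast (hr m).1
  have h2 : 0 ≤ ∑ m, (d m : ℝ) * (r m : ℝ) := Finset.sum_nonneg fun m _ => by positivity
  rw [dof]
  linarith

/-- Up to a factor depending on `M`, the degrees of freedom are those of the core or of a single
loading matrix; if the core is a single number, they may be bounded by a constant. -/
lemma exists_isFreeFamily (hM : 1 ≤ M) (hr : IsTuckerRank d r) :
    dof d r ≤ 2 * (2 * M + 1) ∨
      ∃ (J : Type) (_ : Fintype J) (_ : Nonempty J) (u : Tensor d) (pos : J → Idx d),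
        IsFreeFamily r u pos ∧ (Fintype.card J : ℝ) ≤ dof d r ∧
        dof d r ≤ 2 * (2 * M + 1) * Fintype.card J := by
  have : Nonempty (Fin M) := ⟨⟨0, hM⟩⟩
  have h : ∀ m, r m ≤ d m := fun m => (hr m).2.1
  have hr1 : ∀ m, 1 ≤ r m := fun m => (hr m).1
  set ρ : ℝ := ∏ m, (r m : ℝ) with hρ
  obtain ⟨m, hm⟩ := Finite.exists_max fun m => (d m - r m) * r m
  set N : ℝ := (((d m - r m) * r m : ℕ) : ℝ) with hN
  have hsq : ∀ m, (r m : ℝ) ^ 2 ≤ ρ := by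
    intro m
    have h1 : r m ^ 2 ≤ ∏ j, r j := by
      rw [← Finset.mul_prod_erase _ _ (Finset.mem_univ m), sq]
      exact Nat.mul_le_mul_left _ (hr m).2.2
    rw [hρ]
    exact_mod_cast h1
  have hdr : ∀ m', (d m' : ℝ) * r m' ≤ N + ρ := by
    intro m'
    have h1 : (((d m' - r m') * r m' : ℕ) : ℝ) ≤ N := Nat.cast_le.2 (hm m')
    push_cast [Nat.cast_sub (h m')] at h1
    nlinarith [hsq m']
  have hsum : ∑ m, (d m : ℝ) * (r m : ℝ) ≤ M * (N + ρ) := by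
    refine (Finset.sum_le_sum fun m' _ => hdr m').trans (le_of_eq ?_)
    simp [mul_add]
  have hsum0 : ∀ m, (d m : ℝ) * r m ≤ ∑ m, (d m : ℝ) * (r m : ℝ) := fun m =>
    Finset.single_le_sum (f := fun m => (d m : ℝ) * (r m : ℝ)) (fun i _ => by positivity)
      (Finset.mem_univ m)
  have hM0 : (0 : ℝ) ≤ M := Nat.cast_nonneg M
  have hρ1 : 1 ≤ ∏ m, r m := Finset.one_le_prod' fun m _ => hr1 m
  have hρc : ρ = ((∏ m, r m : ℕ) : ℝ) := by rw [hρ]; push_cast; rfl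
  have hρ1' : (1 : ℝ) ≤ ρ := by rw [hρc]; exact_mod_cast hρ1
  rcases le_or_gt ρ N with hcase | hcase
  · right
    obtain ⟨u, pos, hfree⟩ := exists_isFreeFamily_mode hr m
    have hcard : (Fintype.card (Fin (d m - r m) × Fin (r m)) : ℝ) = N := by simp [hN]
    have hNpos : 0 < Fintype.card (Fin (d m - r m) × Fin (r m)) := by
      have : (0 : ℝ) < Fintype.card (Fin (d m - r m) × Fin (r m)) := by rw [hcard]; linarith
      exact_mod_cast this
    refine ⟨_, inferInstance, Fintype.card_pos_iff.1 hNpos, u, pos, hfree, ?_, ?_⟩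
    · rw [hcard, dof, ← hρ]
      have h1 : N ≤ (d m : ℝ) * r m := by
        rw [hN]
        exact_mod_cast Nat.mul_le_mul_right _ (Nat.sub_le _ _)
      linarith [hsum0 m]
    · rw [hcard, dof, ← hρ]
      nlinarith
  · have hdof : dof d r ≤ (2 * M + 1) * ρ := by
      rw [dof, ← hρ]
      nlinarith
    rcases hρ1.eq_or_lt with h1 | h1
    · left
      have : ρ = 1 := by rw [hρc, ← h1]; simp
      rw [this] at hdof
      linarith
    · right
      let I₀ : Idx r := fun m => ⟨0, hr1 m⟩
      have hcard : Fintype.card {I : Idx r // I ≠ I₀} = ∏ m, r m - 1 := by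
        rw [Fintype.card_subtype_compl, Fintype.card_pi]
        simp
      have hcard' : (Fintype.card {I : Idx r // I ≠ I₀} : ℝ) = ρ - 1 := by
        rw [hcard, Nat.cast_sub hρ1, hρc]
        simp
      have h2 : (2 : ℝ) ≤ ρ := by rw [hρc]; exact_mod_cast h1
      refine ⟨_, inferInstance, Fintype.card_pos_iff.1 (by omega), _, _,
        isFreeFamily_block h I₀, ?_, ?_⟩
      · rw [hcard', dof, ← hρ]
        have : 0 ≤ ∑ m, (d m : ℝ) * (r m : ℝ) := Finset.sum_nonneg fun m _ => by positivity
        linarith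
      · rw [hcard']
        nlinarith

end Positions

/-! ### The quantitative lower bound -/

/-- The factors other than `exp (-Δ² / 8)` are at least exponentially small in `1 + Δ + 1 / Δ²`. -/
lemma exists_exp_le (w : Fin 2 → ℝ) {C D : ℝ} (hC : 0 < C) (hD : 0 < D) :
    ∃ A : ℝ, 0 ≤ A ∧ ∀ Δ : ℝ, 0 < Δ →
      C * Real.exp (-(A * (1 + Δ + 1 / Δ ^ 2))) ≤ D * sepFactor w Δ * (Δ / (1 + Δ)) := by
  set ℓ := |Real.log (w 1 / w 0)| with hℓ
  have hℓ0 : 0 ≤ ℓ := abs_nonneg _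
  have hnt := normalTail_pos
  set E := D * (normalTail * (√(2 * Real.pi))⁻¹ / 8) with hE
  have hE0 : 0 < E := by positivity
  refine ⟨C / E + (4 + 8 * ℓ ^ 2), by positivity, fun Δ hΔ => ?_⟩
  set x := 1 + Δ + 1 / Δ ^ 2 with hx
  have hx1 : 1 ≤ x := by
    have : 0 < 1 / Δ ^ 2 := by positivity
    linarith
  have h1 : C * Real.exp (-(C / E * x)) ≤ E := by
    have h2 : C / E ≤ Real.exp (C / E * x) := by
      have h3 : C / E ≤ C / E * x := le_mul_of_one_le_right (by positivity) hx1
      linarith [Real.add_one_le_exp (C / E * x)]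
    rw [Real.exp_neg, ← div_eq_mul_inv, div_le_iff₀ (Real.exp_pos _)]
    rw [div_le_iff₀ hE0] at h2
    linarith
  have h4 : Real.exp (-Δ⁻¹) ≤ Δ / (1 + Δ) := by
    have h5 := Real.add_one_le_exp Δ⁻¹
    rw [Real.exp_neg]
    have e : Δ / (1 + Δ) = (Δ⁻¹ + 1)⁻¹ := by field_simp
    rw [e]
    exact inv_anti₀ (by positivity) h5
  have h6 : Real.exp (-((4 + 8 * ℓ ^ 2) * x)) ≤
      Real.exp (-(Δ + Δ⁻¹ + (2 * ℓ / Δ + 1) + (2 * ℓ / Δ + 1) ^ 2 / 2)) * Real.exp (-Δ⁻¹) := by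
    rw [← Real.exp_add]
    refine Real.exp_le_exp.2 ?_
    set y := Δ⁻¹ with hy
    have e1 : 1 / Δ ^ 2 = y ^ 2 := by rw [hy, inv_pow, one_div]
    have e2 : 2 * ℓ / Δ = 2 * ℓ * y := by rw [hy, div_eq_mul_inv]
    rw [hx, e1, e2]
    nlinarith [sq_nonneg (y - 1), sq_nonneg (2 * ℓ * y - 1), sq_nonneg ℓ, sq_nonneg y,
      mul_nonneg (sq_nonneg ℓ) hΔ.le, sq_nonneg (ℓ * y)]
  calc C * Real.exp (-((C / E + (4 + 8 * ℓ ^ 2)) * x))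
      = (C * Real.exp (-(C / E * x))) * Real.exp (-((4 + 8 * ℓ ^ 2) * x)) := by
        rw [mul_assoc, ← Real.exp_add]; ring_nf
    _ ≤ E * (Real.exp (-(Δ + Δ⁻¹ + (2 * ℓ / Δ + 1) + (2 * ℓ / Δ + 1) ^ 2 / 2)) *
        (Δ / (1 + Δ))) := by gcongr; exact h6.trans (by gcongr)
    _ = _ := by rw [sepFactor, hE]; ring

/-- The minimax lower bound with an explicit dependence on the signal-to-noise ratio `Δ`, uniformly
over `Δ > 0`. -/
theorem exists_le_minimaxProb {M : ℕ} (hM : 1 ≤ M) {w : Fin 2 → ℝ} (hw : ∀ k, 0 < w k)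
    {C₀ κ₁ κ₂ κ₃ K : ℝ} (hC₀ : 1 ≤ C₀) (hκ₁ : κ₁ ≤ 1) (hκ₂ : 2 ≤ κ₂) (hK : 0 < K)
    {α : ℝ} (hα : 0 < α) :
    ∃ A : ℝ, 0 ≤ A ∧ ∀ (d r : Fin M → ℕ) (n : Fin 2 → ℕ) (n₀ : ℕ) (Δ t : ℝ),
      IsTuckerRank d r → 1 ≤ n₀ → (∀ k, n₀ ≤ n k) → 0 < Δ → dof d r / n₀ ≤ K * Δ →
      t ≤ Real.exp (-(Δ ^ 2 / 8) - A * (1 + Δ + 1 / Δ ^ 2)) * (dof d r / n₀) →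
      ENNReal.ofReal (1 - α) ≤ minimaxProb d r n n₀ C₀ κ₁ κ₂ κ₃ w Δ t := by
  -- Guessing one of `q` values succeeds with probability `1 / q ≤ α / 4`; with `δ = α / 4` and
  -- `exp c - 1 = α ^ 2 / 16`, neighbouring laws have total variation distance at most `α / 4`.
  obtain ⟨q, hq⟩ : ∃ q : ℕ, 4 / α ≤ q := exists_nat_ge _
  have hq0 : (0 : ℝ) < q := lt_of_lt_of_le (by positivity) hq
  have : NeZero q := ⟨by rintro rfl; simp at hq0⟩
  set c := Real.log (1 + α ^ 2 / 16) with hc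
  have hc0 : 0 < c := Real.log_pos (by linarith [show 0 < α ^ 2 / 16 by positivity])
  have hδα : 2 * (1 / (q : ℝ) + (α / 4 / 2 + (Real.exp c - 1) / (2 * (α / 4)))) ≤ α := by
    have h1 : 1 / (q : ℝ) ≤ α / 4 := by
      rw [div_le_iff₀ hq0]
      rw [div_le_iff₀ hα] at hq
      linarith
    rw [hc, Real.exp_log (by positivity)]
    have h2 : (1 + α ^ 2 / 16 - 1) / (2 * (α / 4)) = α / 8 := by field_simp; ring
    rw [h2]
    linarith
  -- The spacing of the grid is `√(τ / n₀)` with `τ = τ₀ Δ / (1 + Δ)`; the three constraints keep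
  -- neighbouring laws close, the midpoints in `[-1 / 2, 1 / 2]`, and the free entries inside the
  -- sphere of radius `Δ`.
  obtain ⟨τ₀, hτ₀, hτc, hτ4, hτK⟩ : ∃ τ₀ : ℝ, 0 < τ₀ ∧ 5 / 2 * (q ^ 2 * τ₀) ≤ c ∧
      q ^ 2 * τ₀ ≤ 1 / 4 ∧ q ^ 2 * τ₀ * K ≤ 3 / 4 := by
    refine ⟨min (min (c / (5 / 2)) (1 / 4)) (3 / 4 / K) / q ^ 2, by positivity, ?_⟩
    rw [mul_div_cancel₀ _ (by positivity)]
    have h1 := min_le_left (min (c / (5 / 2)) (1 / 4)) (3 / 4 / K)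
    have h2 := min_le_right (min (c / (5 / 2)) (1 / 4)) (3 / 4 / K)
    have h3 := min_le_left (c / (5 / 2)) (1 / 4)
    have h4 := min_le_right (c / (5 / 2)) (1 / 4)
    refine ⟨?_, h1.trans h4, ?_⟩
    · have := h1.trans h3
      rw [le_div_iff₀ (by norm_num)] at this
      linarith
    · rwa [le_div_iff₀ hK] at h2
  have hw0 := hw 0
  have hw1 := hw 1
  obtain ⟨A, hA, hAexp⟩ := exists_exp_le w (C := 8 * (2 * M + 1)) (D := √(w 0 * w 1) * τ₀)
    (by positivity) (by positivity)
  refine ⟨A, hA, fun d r n n₀ Δ t hr hn₀ hn hΔ hdof ht => ?_⟩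
  have hn' : (0 : ℝ) < n₀ := by exact_mod_cast hn₀
  have hd : ∀ m, 1 ≤ d m := fun m => (hr m).1.trans (hr m).2.1
  have hsf := sepFactor_pos w Δ
  set τ := τ₀ * (Δ / (1 + Δ)) with hτ
  have hτ0 : 0 < τ := by positivity
  have hu1 : Δ / (1 + Δ) ≤ 1 := by rw [div_le_one (by positivity)]; linarith
  have hu2 : Δ / (1 + Δ) ≤ Δ := div_le_self hΔ.le (by linarith)
  have hττ : τ ≤ τ₀ := mul_le_of_le_one_right hτ₀.le hu1
  have hcτ : 5 / 2 * (q ^ 2 * τ) ≤ c := le_trans (by gcongr) hτc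
  have hτ4' : q ^ 2 * τ ≤ 1 / 4 := le_trans (by gcongr) hτ4
  have hKτ : q ^ 2 * τ * K ≤ 3 / 4 * Δ := by
    calc q ^ 2 * τ * K = (q ^ 2 * τ₀ * K) * (Δ / (1 + Δ)) := by rw [hτ]; ring
      _ ≤ 3 / 4 * Δ := by gcongr
  -- any `N` that carries the degrees of freedom gives the required bound on `t`
  have htN : ∀ N : ℝ, 0 ≤ N → dof d r ≤ 2 * (2 * M + 1) * N → 4 * t ≤
      √(w 0 * w 1) * Real.exp (-(Δ ^ 2 / 8)) * sepFactor w Δ * (τ / n₀) * N := by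
    intro N hN hdN
    have hexp := hAexp Δ hΔ
    calc 4 * t ≤ 4 * (Real.exp (-(Δ ^ 2 / 8) - A * (1 + Δ + 1 / Δ ^ 2)) *
          (2 * (2 * M + 1) * N / n₀)) := by gcongr; exact ht.trans (by gcongr)
      _ = Real.exp (-(Δ ^ 2 / 8)) *
          (8 * (2 * M + 1) * Real.exp (-(A * (1 + Δ + 1 / Δ ^ 2)))) * (N / n₀) := by
        rw [sub_eq_add_neg, Real.exp_add]; ring
      _ ≤ Real.exp (-(Δ ^ 2 / 8)) *
          (√(w 0 * w 1) * τ₀ * sepFactor w Δ * (Δ / (1 + Δ))) * (N / n₀) := by gcongr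
      _ = _ := by rw [hτ]; ring
  rcases exists_isFreeFamily hM hr with h1 | ⟨J, _, _, u, pos, hfree, hJ, hJ'⟩
  · have h : ∀ m, r m ≤ d m := fun m => (hr m).2.1
    let I₀ : Idx r := fun m => ⟨0, (hr m).1⟩
    have hf := isFreeFamily_block h I₀
    have htucker := hf.tucker Δ 0
    have hz : placeAt (fun I : {I : Idx r // I ≠ I₀} => blockEmb h I) 0 = 0 := by
      funext I; simp [placeAt]
    rw [hz, add_zero] at htucker
    refine le_minimaxProb_of_shift hM hd hn₀ hn hC₀ hκ₁ hκ₂ hw hΔ (by positivity : 0 < α / 4) hδα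
      hτ0 hcτ hτ4' ?_ htucker ?_
    · rw [smul_dotProduct, dotProduct_smul, hf.unit, smul_eq_mul, smul_eq_mul]; ring
    · have := htN 1 zero_le_one (by linarith)
      rwa [mul_one] at this
  · refine le_minimaxProb_of_directions hM hd hn₀ hn hC₀ hκ₁ hκ₂ hw hΔ
      (by positivity : 0 < α / 4) hδα hτ0 hcτ hKτ ?_ hfree.injective hfree.unit hfree.vanish
      hfree.tucker (htN _ (by positivity) hJ')
    rw [div_le_iff₀ hn'] at hdof
    linarith

end TensorLDA

end

theorem theorem3 (M : ℕ) (hM : 1 ≤ M) (w : Fin 2 → ℝ) (hw : ∀ k, 0 < w k) (hw1 : w 0 + w 1 = 1)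
    (C₀ κ₁ κ₂ κ₃ K : ℝ) (hC₀ : 1 ≤ C₀) (hκ₁ : 0 < κ₁) (hκ₁' : κ₁ ≤ 1) (hκ₂ : 2 ≤ κ₂)
    (hκ₃ : 0 < κ₃) (hK : 0 < K) (α : ℝ) (hα : 0 < α) :
    (∀ c₁ c₂ : ℝ, 0 < c₁ → c₁ < c₂ → ∃ Cα : ℝ, 0 < Cα ∧
      ∀ (d r : Fin M → ℕ) (n : Fin 2 → ℕ) (n₀ : ℕ) (Δ : ℝ),
        TensorLDA.IsTuckerRank d r → 1 ≤ n₀ → (∀ k, n₀ ≤ n k) →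
        c₁ < Δ → Δ ≤ c₂ → TensorLDA.dof d r / n₀ ≤ K * Δ →
        ENNReal.ofReal (1 - α) ≤
          TensorLDA.minimaxProb d r n n₀ C₀ κ₁ κ₂ κ₃ w Δ (Cα * (TensorLDA.dof d r / n₀))) ∧
    (∃ Cα : ℝ, 0 < Cα ∧
      ∀ (d r : ℕ → Fin M → ℕ) (n : ℕ → Fin 2 → ℕ) (n₀ : ℕ → ℕ) (Δ : ℕ → ℝ),
        (∀ t, TensorLDA.IsTuckerRank (d t) (r t)) → (∀ t, 1 ≤ n₀ t) → (∀ t k, n₀ t ≤ n t k) →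
        Tendsto Δ atTop atTop → (∀ t, TensorLDA.dof (d t) (r t) / n₀ t ≤ K * Δ t) →
        ∃ ϑ : ℕ → ℝ, Tendsto ϑ atTop (𝓝 0) ∧ ∀ t,
          ENNReal.ofReal (1 - α) ≤
            TensorLDA.minimaxProb (d t) (r t) (n t) (n₀ t) C₀ κ₁ κ₂ κ₃ w (Δ t)
              (Cα * Real.exp (-(1 / 8 + ϑ t) * Δ t ^ 2) * (TensorLDA.dof (d t) (r t) / n₀ t))) := by
  obtain ⟨A, hA, hmain⟩ := TensorLDA.exists_le_minimaxProb (κ₃ := κ₃) hM hw hC₀ hκ₁' hκ₂ hK hα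
  have hdof : ∀ (d r : Fin M → ℕ) (n₀ : ℕ), TensorLDA.IsTuckerRank d r → 1 ≤ n₀ →
      0 < TensorLDA.dof d r / n₀ := fun d r n₀ hr hn₀ =>
    div_pos (TensorLDA.dof_pos hr) (by exact_mod_cast hn₀)
  refine ⟨fun c₁ c₂ hc₁ hc₂ => ⟨Real.exp (-(c₂ ^ 2 / 8) - A * (1 + c₂ + 1 / c₁ ^ 2)),
    Real.exp_pos _, fun d r n n₀ Δ hr hn₀ hn hΔ₁ hΔ₂ hK' => ?_⟩, 1, one_pos,
    fun d r n n₀ Δ hr hn₀ hn hΔ hK' => ?_⟩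
  · have hΔ : 0 < Δ := hc₁.trans hΔ₁
    refine hmain d r n n₀ Δ _ hr hn₀ hn hΔ hK' ?_
    have := (hdof d r n₀ hr hn₀).le
    gcongr
  · have hΔ0 : ∀ t, 0 < Δ t := fun t =>
      pos_of_mul_pos_right ((hdof _ _ _ (hr t) (hn₀ t)).trans_le (hK' t)) hK.le
    refine ⟨fun t => A * (1 + Δ t + 1 / Δ t ^ 2) / Δ t ^ 2, ?_, fun t => ?_⟩
    · have h1 : Tendsto (fun t => (Δ t)⁻¹) atTop (𝓝 0) := tendsto_inv_atTop_zero.comp hΔ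
      have h2 : Tendsto (fun t => A * ((Δ t)⁻¹ ^ 2 + (Δ t)⁻¹ + (Δ t)⁻¹ ^ 4)) atTop
          (𝓝 (A * (0 ^ 2 + 0 + 0 ^ 4))) :=
        (((h1.pow 2).add h1).add (h1.pow 4)).const_mul A
      simp only [ne_eq, OfNat.ofNat_ne_zero, not_false_eq_true, zero_pow, add_zero, mul_zero] at h2
      refine h2.congr fun t => ?_
      have := (hΔ0 t).ne'
      field_simp
    · refine hmain _ _ _ _ _ _ (hr t) (hn₀ t) (hn t) (hΔ0 t) (hK' t) (le_of_eq ?_)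
      have := (hΔ0 t).ne'
      rw [one_mul]
      congr 2
      field_simp
      ring
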